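/- Let $d\ge 1$ and let $\mathcal H=L^2(\mathbb R^d)\otimes L^2(\mathbb R^d)$ be the Hilbert space tensor product (inner products are linear in the first variable). For $b\in\mathbb R^d$, $a\in\mathbb R\setminus\{0\}$ and $g\in L^2(\mathbb R^d)$ put $(\pi(b,a)g)(t)=|a|^{-d/2}g(a^{-1}(t-b))$. Call $g\in L^2(\mathbb R^d)$ an admissible wavelet if $0<\int_{\mathbb R^d}|\hat g(\omega)|^2|\omega|^{-d}\,d\omega<\infty$, and rotation invariant if $g\circ R=g$ almost everywhere for every $R\in SO(d)$. Let $X=(\mathbb R^d\times(\mathbb R\setminus\{0\}))^2$ with the product measure $d\mu(b,a)=\frac{db_1\,da_1}{|a_1|^{d+1}}\,\frac{db_2\,da_2}{|a_2|^{d+1}}$, where $b=(b_1,b_2)$, $a=(a_1,a_2)$. For $\varphi_1,\varphi_2\in L^2(\mathbb R^d)$ and $\vec f\in\mathcal H$ let $$W_{\varphi_1\otimes\varphi_2}\vec f(b,a)=\langle \vec f,\ \pi(b_1,a_1)\varphi_1\otimes\pi(b_2,a_2)\varphi_2\rangle .$$ Let $\varphi_1,\varphi_2,\psi_1,\psi_2\in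 L^2(\mathbb R^d)$ be admissible rotation invariant wavelets with $\|\varphi_j\|=\|\psi_j\|=1$, $j=1,2$, let $1\le p<\infty$ and let $m\in L^p(X,\mu)$. Then there is exactly one bounded linear operator $M$ on $\mathcal H$ such that $$\langle M\vec f,\vec g\rangle=\int_X m\;W_{\varphi_1\otimes\varphi_2}\vec f\;\overline{W_{\psi_1\otimes\psi_2}\vec g}\;d\mu\qquad\text{for all }\vec f,\vec g\in\mathcal H,$$ all these integrals being absolutely convergent (the bilinear wavelet, or Calderón–Toeplitz, localization operator with symbol $m$), and $M$ belongs to the Schatten class $\mathcal S_p(\mathcal H)$: $M$ is compact and its singular values, i.e. the eigenvalues of $(M^*M)^{1/2}$ counted with multiplicity, form a $p$-summable family. -/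

import Mathlib

open MeasureTheory FourierTransform TensorProduct
open scoped ENNReal NNReal

noncomputable section

/-- Euclidean space `ℝ^d`. -/
abbrev Eucl (d : ℕ) : Type := EuclideanSpace ℝ (Fin d)

/-- The Hilbert space `L²(ℝ^d)` of complex-valued functions. -/
abbrev L2 (d : ℕ) : Type := Lp ℂ 2 (volume : Measure (Eucl d))

/-- The Hilbert space tensor product `L²(ℝ^d) ⊗ L²(ℝ^d)`: the completion of the algebraic tensor
product with respect to `⟪f₁ ⊗ f₂, g₁ ⊗ g₂⟫ = ⟪f₁, g₁⟫ ⟪f₂, g₂⟫`. -/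
abbrev L2Tensor (d : ℕ) : Type := UniformSpace.Completion (L2 d ⊗[ℂ] L2 d)

/-- The simple tensor `f₁ ⊗ f₂` in `L²(ℝ^d) ⊗ L²(ℝ^d)`. -/
def simpleTensor {d : ℕ} (f₁ f₂ : L2 d) : L2Tensor d :=
  ((f₁ ⊗ₜ[ℂ] f₂ : L2 d ⊗[ℂ] L2 d) : UniformSpace.Completion (L2 d ⊗[ℂ] L2 d))

/-! ### Time-scale shifts -/

/-- The parameter space `ℝ^d × (ℝ ∖ {0})`, with points `(b, a)`. -/
abbrev TimeScale (d : ℕ) : Type := Eucl d × {a : ℝ // a ≠ 0}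

/-- The left Haar measure `db da / |a|^(d+1)` on `ℝ^d × (ℝ ∖ {0})`. -/
def timeScaleMeasure (d : ℕ) : Measure (TimeScale d) :=
  ((volume : Measure (Eucl d)).prod
    (Measure.comap Subtype.val (volume : Measure ℝ))).withDensity
    fun x => ENNReal.ofReal (1 / |(x.2 : ℝ)| ^ (d + 1))

theorem memLp_timeScaleShift {d : ℕ} (x : TimeScale d) (g : L2 d) :
    MemLp (fun t : Eucl d =>
      ((|(x.2 : ℝ)| ^ (-(d : ℝ) / 2) : ℝ) : ℂ) * g ((x.2 : ℝ)⁻¹ • (t - x.1))) 2 volume := by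
  obtain ⟨b, a, ha⟩ := x
  refine MemLp.const_mul ?_ _
  have hinv : a⁻¹ ≠ 0 := inv_ne_zero ha
  have h1 : MemLp (fun t : Eucl d => g (a⁻¹ • t)) 2 volume := by
    have he := (Homeomorph.smulOfNeZero (α := Eucl d) a⁻¹ hinv).measurableEmbedding
    refine (MeasurableEmbedding.memLp_map_measure_iff (g := fun t => g t) he).1 ?_
    have hm : Measure.map (Homeomorph.smulOfNeZero (α := Eucl d) a⁻¹ hinv) volume
        = ENNReal.ofReal |(a⁻¹ ^ Module.finrank ℝ (Eucl d))⁻¹| • volume :=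
      Measure.map_addHaar_smul volume hinv
    rw [hm]
    exact (Lp.memLp g).smul_measure ENNReal.ofReal_ne_top
  exact h1.comp_measurePreserving (measurePreserving_sub_right volume b)

/-- The time-scale shift `(T_b D_a g)(t) = |a|^(-d/2) g(a⁻¹ (t - b))` of `g ∈ L²(ℝ^d)`. -/
def timeScaleShift {d : ℕ} (x : TimeScale d) (g : L2 d) : L2 d :=
  (memLp_timeScaleShift x g).toLp _

/-- The tensor product time-scale shift of `φ₁ ⊗ φ₂`: the vector
`(T_{b₁} D_{a₁} φ₁) ⊗ (T_{b₂} D_{a₂} φ₂)` at `((b₁, a₁), (b₂, a₂))`. -/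
def tensorShift {d : ℕ} (φ₁ φ₂ : L2 d) (x : TimeScale d × TimeScale d) : L2Tensor d :=
  simpleTensor (timeScaleShift x.1 φ₁) (timeScaleShift x.2 φ₂)

/-- The tensor product continuous wavelet transform
`W_{φ₁ ⊗ φ₂} f (b, a) = ⟨f, (T_{b₁} D_{a₁} φ₁) ⊗ (T_{b₂} D_{a₂} φ₂)⟩`, where `⟨·,·⟩` is linear in
the first variable, that is, `⟨f, g⟩ = inner ℂ g f`. -/
def waveletTransform {d : ℕ} (φ₁ φ₂ : L2 d) (f : L2Tensor d) (x : TimeScale d × TimeScale d) : ℂ :=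
  inner ℂ (tensorShift φ₁ φ₂ x) f

/-! ### Wavelets -/

/-- `g` is an admissible wavelet: `0 < ∫ |ĝ(ω)|² / |ω|^d dω < ∞`. Here `𝓕` is the Fourier transform
on `L²` that extends `ĝ(ω) = ∫ g(t) exp(-2πi⟨t, ω⟩) dt`. -/
def IsAdmissible {d : ℕ} (g : L2 d) : Prop :=
  0 < ∫⁻ ω : Eucl d, ‖(𝓕 g : L2 d) ω‖ₑ ^ 2 / ‖ω‖ₑ ^ d ∧
    ∫⁻ ω : Eucl d, ‖(𝓕 g : L2 d) ω‖ₑ ^ 2 / ‖ω‖ₑ ^ d < ∞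

/-- `g ∘ R = g` almost everywhere, for every rotation `R ∈ SO(d)`. -/
def IsRotationInvariant {d : ℕ} (g : L2 d) : Prop :=
  ∀ R : Eucl d ≃ₗᵢ[ℝ] Eucl d,
    LinearMap.det (R.toLinearEquiv : Eucl d →ₗ[ℝ] Eucl d) = 1 →
      (fun t => g (R t)) =ᵐ[volume] g

/-! ### Localization operators and Schatten classes -/

/-- The bounded operator `M` is the bilinear localization operator with symbol `m`, analysis
wavelet `φ₁ ⊗ φ₂` and synthesis wavelet `ψ₁ ⊗ ψ₂`: for all `f, g`,
`⟨M f, g⟩ = ∫ m · W_{φ₁ ⊗ φ₂} f · conj (W_{ψ₁ ⊗ ψ₂} g)`, the integral being absolutely convergent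
with respect to the product of the two left Haar measures. -/
def IsLocalizationOperator {d : ℕ} (m : TimeScale d × TimeScale d → ℂ) (φ₁ φ₂ ψ₁ ψ₂ : L2 d)
    (M : L2Tensor d →L[ℂ] L2Tensor d) : Prop :=
  ∀ f g : L2Tensor d,
    Integrable (fun x => m x * waveletTransform φ₁ φ₂ f x *
        (starRingEnd ℂ) (waveletTransform ψ₁ ψ₂ g x))
      ((timeScaleMeasure d).prod (timeScaleMeasure d)) ∧
    inner ℂ g (M f) = ∫ x, m x * waveletTransform φ₁ φ₂ f x *
        (starRingEnd ℂ) (waveletTransform ψ₁ ψ₂ g x)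
      ∂((timeScaleMeasure d).prod (timeScaleMeasure d))

/-- `T` belongs to the Schatten class `S_p`: it is compact, and its singular values, i.e. the
eigenvalues of `|T| = (T† T)^(1/2)` repeated according to their multiplicity, are `p`-summable.
(The eigenvalue `0` contributes `0`; all other eigenspaces of the compact operator `|T|` have finite
dimension.) -/
def IsSchatten {H : Type*} [NormedAddCommGroup H] [InnerProductSpace ℂ H] [CompleteSpace H]
    (p : ℝ) (T : H →L[ℂ] H) : Prop :=
  IsCompactOperator T ∧
    Summable fun s : ℝ≥0 =>
      (Module.finrank ℂ
        (Module.End.eigenspace (CFC.abs T : H →L[ℂ] H).toLinearMap ((s : ℝ) : ℂ)) : ℝ) *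
        (s : ℝ) ^ p

end

/-! The proof has an abstract half and a concrete half.

Abstract half: let Φ, Ψ be families in the unit ball satisfying a Bessel inequality with constant C.
Since |m| ≤ 1 + |m|^p, the sesquilinear form is bounded and defines M
(`exists_localization_operator`). For orthonormal e_k, g_k put w_k = |⟨Φ, e_k⟩| |⟨Ψ, g_k⟩|. Each w_k
has mass at most C by Cauchy–Schwarz, and ∑ w_k ≤ 1 pointwise by Bessel's inequality in H, so Jensen
gives ∑ |⟨M e_k, g_k⟩|^p ≤ C^(p-1) ∫ |m|^p; no interpolation is needed. Such a uniform bound forces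
compactness, and with e_k eigenvectors of |M| and g_k = M e_k / s_k it bounds the sums of p-th
powers of singular values (`isSchatten_of_sum_inner_rpow_le`).

Concrete half: the shifts of one wavelet φ form a Bessel family
(`exists_isBesselFamily_timeScaleShift`), and Bessel families are stable under tensor products
(`IsBesselFamily.tensor`). Plancherel in the translation b turns ∫ |⟨f, π(b,a)φ⟩|² dμ into at most ∫
|f̂(ω)|² K(ω) dω, where K(ω) = ∫ |φ̂(aω)|² da/|a|. This K is homogeneous of degree 0, invariant
almost everywhere under each rotation and, by admissibility, integrable on annuli. Lebesgue
differentiation then makes it a finite constant almost everywhere (`ae_eq_const_of_homogeneous`). -/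

/-! ### A Schatten class criterion by matrix coefficients -/

section Schatten

variable {H : Type*} [NormedAddCommGroup H] [InnerProductSpace ℂ H]

theorem orthonormal_cons_of_mem_orthogonal {n : ℕ} {e : Fin n → H} (he : Orthonormal ℂ e)
    {u : H} (hu : ‖u‖ = 1) (hue : u ∈ (Submodule.span ℂ (Set.range e))ᗮ) :
    Orthonormal ℂ (Fin.cons u e : Fin (n + 1) → H) := by
  have horth : ∀ i, inner ℂ u (e i) = 0 := fun i =>
    (Submodule.mem_orthogonal' _ _).1 hue _ (Submodule.subset_span ⟨i, rfl⟩)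
  have := (orthonormal_vecCons_iff (𝕜 := ℂ) (v := u) (vs := e)).2 ⟨hu, horth, he⟩
  exact this

/-- If `ε` bounds all matrix coefficients of `M` between unit vectors orthogonal to `P` and `Q`,
then it bounds the norm of the compression. -/
theorem norm_compression_le {M : H →L[ℂ] H} {P Q : Submodule ℂ H} [P.HasOrthogonalProjection]
    [Q.HasOrthogonalProjection] {ε : ℝ} (hε : 0 ≤ ε)
    (h : ∀ u ∈ Pᗮ, ∀ v ∈ Qᗮ, ‖u‖ = 1 → ‖v‖ = 1 → ‖inner ℂ v (M u)‖ ≤ ε) :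
    ‖Qᗮ.starProjection ∘L M ∘L Pᗮ.starProjection‖ ≤ ε := by
  have hbound : ∀ u ∈ Pᗮ, ∀ v ∈ Qᗮ, ‖inner ℂ v (M u)‖ ≤ ε * ‖u‖ * ‖v‖ := by
    intro u hu v hv
    rcases eq_or_ne u 0 with rfl | hu0
    · simp
    rcases eq_or_ne v 0 with rfl | hv0
    · simp
    have := h ((‖u‖⁻¹ : ℂ) • u) (Pᗮ.smul_mem _ hu) ((‖v‖⁻¹ : ℂ) • v) (Qᗮ.smul_mem _ hv)
      (norm_smul_inv_norm hu0) (norm_smul_inv_norm hv0)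
    rw [map_smul, inner_smul_left, inner_smul_right, norm_mul, norm_mul] at this
    have hu1 : 0 < ‖u‖ := norm_pos_iff.2 hu0
    have hv1 : 0 < ‖v‖ := norm_pos_iff.2 hv0
    simp only [map_inv₀, Complex.conj_ofReal, norm_inv, Complex.norm_real, norm_norm] at this
    calc ‖inner ℂ v (M u)‖ = (‖v‖⁻¹ * (‖u‖⁻¹ * ‖inner ℂ v (M u)‖)) * (‖u‖ * ‖v‖) := by
          field_simp
      _ ≤ ε * (‖u‖ * ‖v‖) := by gcongr
      _ = _ := by ring
  refine ContinuousLinearMap.opNorm_le_of_re_inner_le hε fun x y hx hy => ?_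
  refine (RCLike.re_le_norm _).trans ?_
  rw [norm_inner_symm, ContinuousLinearMap.comp_apply, ContinuousLinearMap.comp_apply,
    ← Submodule.inner_starProjection_left_eq_right]
  refine (hbound _ (Submodule.starProjection_apply_mem _ _) _
    (Submodule.starProjection_apply_mem _ _)).trans ?_
  have h1 : ‖Pᗮ.starProjection x‖ ≤ 1 := hx ▸ Submodule.norm_starProjection_apply_le _ x
  have h2 : ‖Qᗮ.starProjection y‖ ≤ 1 := hy ▸ Submodule.norm_starProjection_apply_le _ y
  calc ε * ‖Pᗮ.starProjection x‖ * ‖Qᗮ.starProjection y‖ ≤ ε * 1 * 1 := by gcongr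
    _ = ε := by ring

theorem isCompactOperator_starProjection (P : Submodule ℂ H) [FiniteDimensional ℂ P] :
    IsCompactOperator P.starProjection := by
  have : ProperSpace P := FiniteDimensional.proper ℂ P
  have h : IsCompactOperator P.orthogonalProjectionOnto :=
    isCompactOperator_of_locallyCompactSpace_dom P.orthogonalProjectionOnto
  exact h.clm_comp P.subtypeL

variable [CompleteSpace H]

/-- An operator whose matrix coefficients along finite orthonormal families have bounded `ℓ^p`
sums is compact. -/
theorem isCompactOperator_of_sum_inner_rpow_le {M : H →L[ℂ] H} {p K : ℝ} (hp : 0 < p)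
    (hM : ∀ (n : ℕ) (e g : Fin n → H), Orthonormal ℂ e → Orthonormal ℂ g →
      ∑ k, ‖inner ℂ (g k) (M (e k))‖ ^ p ≤ K) :
    IsCompactOperator M := by
  have key : ∀ ε : ℝ, 0 < ε → ∃ T : H →L[ℂ] H, IsCompactOperator T ∧ dist T M ≤ ε := by
    intro ε hε
    -- The lengths of pairs of families with all coefficients at least ε. Such an n satisfies n ε^p
    -- ≤ K, so a longest pair exists. It cannot be extended, so all coefficients orthogonal to it
    -- are below ε.
    let A : Set ℕ := {n | ∃ e g : Fin n → H, Orthonormal ℂ e ∧ Orthonormal ℂ g ∧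
      ∀ k, ε ≤ ‖inner ℂ (g k) (M (e k))‖}
    have hA0 : A.Nonempty := by
      refine ⟨0, Fin.elim0, Fin.elim0, ?_, ?_, fun k => k.elim0⟩ <;>
      exact ⟨fun k => k.elim0, fun k => k.elim0⟩
    have hAb : BddAbove A := by
      refine ⟨⌈K / ε ^ p⌉₊, ?_⟩
      rintro n ⟨e, g, he, hg, hk⟩
      have h1 : ∑ _k : Fin n, ε ^ p ≤ K :=
        (Finset.sum_le_sum fun k _ => Real.rpow_le_rpow hε.le (hk k) hp.le).trans (hM n e g he hg)
      have h2 : (n : ℝ) ≤ K / ε ^ p := by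
        rw [le_div_iff₀ (Real.rpow_pos_of_pos hε p)]
        simpa using h1
      exact_mod_cast h2.trans (Nat.le_ceil _)
    obtain ⟨e, g, he, hg, hk⟩ := Nat.sSup_mem hA0 hAb
    have hmax : sSup A + 1 ∉ A := fun h => absurd (le_csSup hAb h) (by omega)
    set P := Submodule.span ℂ (Set.range e) with hP
    set Q := Submodule.span ℂ (Set.range g) with hQ
    have : FiniteDimensional ℂ P := FiniteDimensional.span_of_finite ℂ (Set.finite_range e)
    have : FiniteDimensional ℂ Q := FiniteDimensional.span_of_finite ℂ (Set.finite_range g)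
    have hsmall : ‖Qᗮ.starProjection ∘L M ∘L Pᗮ.starProjection‖ ≤ ε := by
      refine norm_compression_le hε.le fun u hu v hv hu1 hv1 => ?_
      by_contra hlt
      push Not at hlt
      refine hmax ⟨Fin.cons u e, Fin.cons v g, orthonormal_cons_of_mem_orthogonal he hu1 hu,
        orthonormal_cons_of_mem_orthogonal hg hv1 hv, fun k => ?_⟩
      refine Fin.cases ?_ (fun k => ?_) k
      · simpa using hlt.le
      · simpa using hk k
    -- This T has finite rank and M - T is exactly the compression of M to Pᗮ and Qᗮ.
    refine ⟨Q.starProjection ∘L M + Qᗮ.starProjection ∘L M ∘L P.starProjection, ?_, ?_⟩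
    · refine IsCompactOperator.add ?_ ?_
      · exact (isCompactOperator_starProjection Q).comp_clm M
      · exact (isCompactOperator_starProjection P).clm_comp (Qᗮ.starProjection ∘L M)
    · rw [dist_comm, dist_eq_norm]
      refine le_of_eq_of_le (congrArg _ ?_) hsmall
      ext x
      simp [Submodule.starProjection_orthogonal']
      abel
  have hmem : M ∈ closure {T : H →L[ℂ] H | IsCompactOperator T} := by
    refine Metric.mem_closure_iff.2 fun ε hε => ?_
    obtain ⟨T, hT, hd⟩ := key (ε / 2) (by positivity)
    exact ⟨T, hT, by rw [dist_comm]; linarith⟩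
  have hcl : IsClosed {T : H →L[ℂ] H | IsCompactOperator T} :=
    isClosed_setOfPred_isCompactOperator
  rwa [hcl.closure_eq] at hmem

/-- Both sides equal ⟨x, M†M y⟩. This replaces the polar decomposition. -/
theorem inner_apply_apply_eq_inner_abs (M : H →L[ℂ] H) (x y : H) :
    inner ℂ (M x) (M y) = inner ℂ ((CFC.abs M : H →L[ℂ] H) x) ((CFC.abs M : H →L[ℂ] H) y) := by
  have hsa : IsSelfAdjoint (CFC.abs M : H →L[ℂ] H) := IsSelfAdjoint.of_nonneg (CFC.abs_nonneg M)
  have h2 : (CFC.abs M : H →L[ℂ] H) ((CFC.abs M : H →L[ℂ] H) y) = star M (M y) :=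
    congrArg (fun T : H →L[ℂ] H => T y) (CFC.abs_mul_abs M)
  calc inner ℂ (M x) (M y) = inner ℂ x (star M (M y)) := by
        rw [ContinuousLinearMap.star_eq_adjoint, ContinuousLinearMap.adjoint_inner_right]
    _ = inner ℂ x ((CFC.abs M : H →L[ℂ] H) ((CFC.abs M : H →L[ℂ] H) y)) := by rw [h2]
    _ = _ := by
        rw [← ContinuousLinearMap.adjoint_inner_left, ← ContinuousLinearMap.star_eq_adjoint,
          hsa.star_eq]

/-- The sum of the `p`-th powers of the singular values along an orthonormal family of
eigenvectors of `|M|` is a sum of matrix coefficients of `M`. -/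
theorem sum_singularValue_rpow_le {M : H →L[ℂ] H} {p K : ℝ}
    (hM : ∀ (n : ℕ) (e g : Fin n → H), Orthonormal ℂ e → Orthonormal ℂ g →
      ∑ k, ‖inner ℂ (g k) (M (e k))‖ ^ p ≤ K)
    {ι : Type*} [Fintype ι] {e : ι → H} (he : Orthonormal ℂ e) {s : ι → ℝ≥0} (hs : ∀ i, s i ≠ 0)
    (hse : ∀ i, (CFC.abs M : H →L[ℂ] H) (e i) = ((s i : ℝ) : ℂ) • e i) :
    ∑ i, (s i : ℝ) ^ p ≤ K := by
  classical
  have hs' : ∀ i, ((s i : ℝ) : ℂ) ≠ 0 := fun i => by exact_mod_cast hs i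
  have hMM : ∀ i j, inner ℂ (M (e i)) (M (e j)) =
      ((s i : ℝ) : ℂ) * (((s j : ℝ) : ℂ) * (if i = j then 1 else 0)) := by
    intro i j
    rw [inner_apply_apply_eq_inner_abs, hse, hse, inner_smul_left, inner_smul_right,
      (orthonormal_iff_ite.1 he)]
    simp
  -- The left singular vectors; against them the coefficient of M at e i is the singular value
  -- itself.
  let g : ι → H := fun i => (((s i : ℝ) : ℂ))⁻¹ • M (e i)
  have hg : Orthonormal ℂ g := by
    rw [orthonormal_iff_ite]
    intro i j
    simp only [g]
    rw [inner_smul_left, inner_smul_right, hMM]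
    split_ifs with hij
    · subst hij
      have := hs' i
      simp only [map_inv₀, Complex.conj_ofReal]
      field_simp
    · simp
  have hval : ∀ i, ‖inner ℂ (g i) (M (e i))‖ = s i := by
    intro i
    have := hs' i
    simp only [g]
    rw [inner_smul_left, hMM]
    simp [this]
  let σ := (Fintype.equivFin ι).symm
  have := hM _ (e ∘ σ) (g ∘ σ) (he.comp _ σ.injective) (hg.comp _ σ.injective)
  simp only [Function.comp_apply, hval] at this
  rwa [Equiv.sum_comp σ (fun i => (s i : ℝ) ^ p)] at this

/-- If the matrix coefficients of `M` along finite orthonormal families have bounded `ℓ^p` sums,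
then `M` is of Schatten class `S_p`. -/
theorem isSchatten_of_sum_inner_rpow_le {M : H →L[ℂ] H} {p K : ℝ} (hp : 0 < p)
    (hM : ∀ (n : ℕ) (e g : Fin n → H), Orthonormal ℂ e → Orthonormal ℂ g →
      ∑ k, ‖inner ℂ (g k) (M (e k))‖ ^ p ≤ K) :
    IsSchatten p M := by
  classical
  refine ⟨isCompactOperator_of_sum_inner_rpow_le hp hM, ?_⟩
  set T : H →ₗ[ℂ] H := (CFC.abs M : H →L[ℂ] H).toLinearMap
  have hsa : IsSelfAdjoint (CFC.abs M : H →L[ℂ] H) := IsSelfAdjoint.of_nonneg (CFC.abs_nonneg M)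
  have hsymm : T.IsSymmetric := hsa.isSymmetric
  refine summable_of_sum_le (c := K) (fun s => by positivity) fun u => ?_
  let V := fun z : ℂ => Module.End.eigenspace T z
  -- The discarded terms vanish: 0 ^ p = 0 because p > 0, and `Module.finrank` is 0 by default on an
  -- infinite-dimensional space.
  let u' : Finset ℝ≥0 := u.filter fun s => s ≠ 0 ∧ FiniteDimensional ℂ (V ((s : ℝ) : ℂ))
  have hsum : ∑ s ∈ u, (Module.finrank ℂ (V ((s : ℝ) : ℂ)) : ℝ) * (s : ℝ) ^ p =
      ∑ s ∈ u', (Module.finrank ℂ (V ((s : ℝ) : ℂ)) : ℝ) * (s : ℝ) ^ p := by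
    refine (Finset.sum_filter_of_ne fun s _ hne => ⟨?_, ?_⟩).symm
    · rintro rfl
      simp [Real.zero_rpow hp.ne'] at hne
    · by_contra hfin
      rw [Module.finrank_of_not_finite hfin] at hne
      simp at hne
  rw [hsum]
  have hfd : ∀ s : u', FiniteDimensional ℂ (V (((s : ℝ≥0) : ℝ) : ℂ)) := fun s =>
    (Finset.mem_filter.1 s.2).2.2
  have hVO : OrthogonalFamily ℂ (fun s : u' => V (((s : ℝ≥0) : ℝ) : ℂ))
      fun s => (V (((s : ℝ≥0) : ℝ) : ℂ)).subtypeₗᵢ :=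
    hsymm.orthogonalFamily_eigenspaces.comp (γ := u') (f := fun s => (((s : ℝ≥0) : ℝ) : ℂ))
      fun a b hab => Subtype.ext (NNReal.coe_injective (Complex.ofReal_injective hab))
  let b := fun s : u' => stdOrthonormalBasis ℂ (V (((s : ℝ≥0) : ℝ) : ℂ))
  have hon := hVO.orthonormal_sigma_orthonormal (v_family := fun s => b s)
    fun s => (b s).orthonormal
  have := sum_singularValue_rpow_le hM hon (s := fun a => (a.1 : ℝ≥0))
    (fun a => (Finset.mem_filter.1 a.1.2).2.1)
    (fun a => Module.End.mem_eigenspace_iff.1 ((b a.1) a.2).2)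
  rw [Fintype.sum_sigma] at this
  simp only [Finset.sum_const, Finset.card_univ, Fintype.card_fin, nsmul_eq_mul] at this
  rw [← Finset.sum_coe_sort u']
  exact this

end Schatten

/-! ### Continuous Bessel families and weighted inequalities -/

section Bessel

variable {H : Type*} [NormedAddCommGroup H] [InnerProductSpace ℂ H]
  {X : Type*} [MeasurableSpace X] {μ : Measure X}

/-- A weakly measurable family of vectors satisfying the (continuous) Bessel inequality
`∫ |⟨Φ x, f⟩|² dμ(x) ≤ C ‖f‖²`. -/
structure IsBesselFamily (Φ : X → H) (μ : Measure X) (C : ℝ≥0) : Prop where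
  measurable_inner : ∀ f : H, Measurable fun x => (inner ℂ (Φ x) f : ℂ)
  lintegral_le : ∀ f : H, ∫⁻ x, ‖(inner ℂ (Φ x) f : ℂ)‖ₑ ^ 2 ∂μ ≤ C * ‖f‖ₑ ^ 2

theorem IsBesselFamily.mono {Φ : X → H} {C D : ℝ≥0} (h : IsBesselFamily Φ μ C) (hCD : C ≤ D) :
    IsBesselFamily Φ μ D :=
  ⟨h.measurable_inner, fun f => (h.lintegral_le f).trans (by gcongr)⟩

/-- Cauchy–Schwarz in L²(μ); each factor contributes C^(1/2). -/
theorem IsBesselFamily.lintegral_mul_le {Φ Ψ : X → H} {C : ℝ≥0} (hΦ : IsBesselFamily Φ μ C)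
    (hΨ : IsBesselFamily Ψ μ C) (f g : H) :
    ∫⁻ x, ‖(inner ℂ (Φ x) f : ℂ)‖ₑ * ‖(inner ℂ (Ψ x) g : ℂ)‖ₑ ∂μ ≤ C * (‖f‖ₑ * ‖g‖ₑ) := by
  refine (ENNReal.lintegral_mul_le_Lp_mul_Lq μ Real.HolderConjugate.two_two
    (hΦ.measurable_inner f).enorm.aemeasurable (hΨ.measurable_inner g).enorm.aemeasurable).trans ?_
  have h2 : (0 : ℝ) ≤ 1 / 2 := by norm_num
  have key : ∀ {Θ : X → H}, IsBesselFamily Θ μ C → ∀ u : H,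
      (∫⁻ x, ‖(inner ℂ (Θ x) u : ℂ)‖ₑ ^ (2 : ℝ) ∂μ) ^ (1 / 2 : ℝ) ≤
        (C : ℝ≥0∞) ^ (1 / 2 : ℝ) * ‖u‖ₑ := by
    intro Θ hΘ u
    have h := ENNReal.rpow_le_rpow (hΘ.lintegral_le u) h2
    rw [ENNReal.mul_rpow_of_nonneg _ _ h2, ← ENNReal.rpow_two, ← ENNReal.rpow_mul] at h
    simpa using h
  refine (mul_le_mul' (key hΦ f) (key hΨ g)).trans (le_of_eq ?_)
  rw [mul_mul_mul_comm, ← ENNReal.rpow_add_of_nonneg _ _ h2 h2]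
  norm_num

/-- By st ≤ (s² + t²)/2 this follows from Bessel's inequality for u along e and for v along g. The
bound does not depend on the number of vectors. -/
theorem sum_enorm_inner_mul_enorm_inner_le {ι : Type*} [Fintype ι] {e g : ι → H}
    (he : Orthonormal ℂ e) (hg : Orthonormal ℂ g) {u v : H} (hu : ‖u‖ ≤ 1) (hv : ‖v‖ ≤ 1) :
    ∑ k, ‖(inner ℂ u (e k) : ℂ)‖ₑ * ‖(inner ℂ v (g k) : ℂ)‖ₑ ≤ 1 := by
  have h1 := he.sum_inner_products_le u (s := Finset.univ)
  have h2 := hg.sum_inner_products_le v (s := Finset.univ)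
  have h3 : ∑ k, ‖(inner ℂ u (e k) : ℂ)‖ * ‖(inner ℂ v (g k) : ℂ)‖ ≤ 1 := by
    have : ∑ k, ‖(inner ℂ u (e k) : ℂ)‖ * ‖(inner ℂ v (g k) : ℂ)‖ ≤
        ∑ k, (‖(inner ℂ (e k) u : ℂ)‖ ^ 2 + ‖(inner ℂ (g k) v : ℂ)‖ ^ 2) / 2 := by
      refine Finset.sum_le_sum fun k _ => ?_
      rw [norm_inner_symm u, norm_inner_symm v]
      nlinarith [sq_nonneg (‖(inner ℂ (e k) u : ℂ)‖ - ‖(inner ℂ (g k) v : ℂ)‖)]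
    rw [← Finset.sum_div, Finset.sum_add_distrib] at this
    nlinarith [norm_nonneg u, norm_nonneg v]
  calc ∑ k, ‖(inner ℂ u (e k) : ℂ)‖ₑ * ‖(inner ℂ v (g k) : ℂ)‖ₑ
      = ENNReal.ofReal (∑ k, ‖(inner ℂ u (e k) : ℂ)‖ * ‖(inner ℂ v (g k) : ℂ)‖) := by
        rw [ENNReal.ofReal_sum_of_nonneg fun k _ => by positivity]
        simp [ENNReal.ofReal_mul]
    _ ≤ 1 := by simpa using ENNReal.ofReal_le_ofReal h3

/-- Jensen's inequality for the power `p` with respect to an unnormalized weight. -/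
theorem lintegral_mul_rpow_le {a w : X → ℝ≥0∞} (ha : AEMeasurable a μ) (hw : AEMeasurable w μ)
    {p : ℝ} (hp : 1 ≤ p) :
    (∫⁻ x, a x * w x ∂μ) ^ p ≤ (∫⁻ x, a x ^ p * w x ∂μ) * (∫⁻ x, w x ∂μ) ^ (p - 1) := by
  have hp0 : 0 < p := by linarith
  have ha' : AEMeasurable a (μ.withDensity w) := ha.mono_ac (withDensity_absolutelyContinuous _ _)
  -- Comparison of the L¹ and L^p norms for the measure w μ. Its total mass enters with exponent 1 -
  -- 1/p, which becomes p - 1 after raising to the power p.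
  have h := eLpNorm_le_eLpNorm_mul_rpow_measure_univ (p := 1) (q := ENNReal.ofReal p)
    (by simpa using hp) ha'.aestronglyMeasurable
  rw [eLpNorm_one_eq_lintegral_enorm, eLpNorm_eq_lintegral_rpow_enorm_toReal (by simpa using hp0)
    ENNReal.ofReal_ne_top, ENNReal.toReal_ofReal hp0.le] at h
  simp only [enorm_eq_self, ENNReal.toReal_one, div_one] at h
  rw [lintegral_withDensity_eq_lintegral_mul₀ hw ha,
    lintegral_withDensity_eq_lintegral_mul₀ hw (ha.pow_const p), withDensity_apply _ .univ,
    Measure.restrict_univ] at h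
  simp only [Pi.mul_apply, mul_comm (w _)] at h
  refine (ENNReal.rpow_le_rpow h hp0.le).trans (le_of_eq ?_)
  rw [ENNReal.mul_rpow_of_nonneg _ _ hp0.le, ← ENNReal.rpow_mul, ← ENNReal.rpow_mul]
  congr 2
  · field_simp; simp
  · field_simp

end Bessel

/-! ### Localization operators over abstract Bessel families -/

section LocalizationOperator

variable {H : Type*} [NormedAddCommGroup H] [InnerProductSpace ℂ H]
  {X : Type*} [MeasurableSpace X] {μ : Measure X} {Φ Ψ : X → H} {C : ℝ≥0} {p : ℝ} {m : X → ℂ}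

theorem lintegral_enorm_rpow_lt_top (hp : 1 ≤ p) (hm : MemLp m (ENNReal.ofReal p) μ) :
    ∫⁻ x, ‖m x‖ₑ ^ p ∂μ < ∞ := by
  have hp0 : 0 < p := by linarith
  have := lintegral_rpow_enorm_lt_top_of_eLpNorm_lt_top (by simpa using hp0)
    ENNReal.ofReal_ne_top hm.2
  rwa [ENNReal.toReal_ofReal hp0.le] at this

theorem enorm_inner_le_of_norm_le_one {u : H} (hu : ‖u‖ ≤ 1) (f : H) :
    ‖(inner ℂ u f : ℂ)‖ₑ ≤ ‖f‖ₑ := by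
  rw [enorm_le_iff_norm_le]
  exact (norm_inner_le_norm u f).trans (mul_le_of_le_one_left (norm_nonneg _) hu)

/-- Split |m| ≤ 1 + |m|^p: the constant 1 is absorbed by the Bessel inequalities, and |m|^p by the
trivial bounds |⟨Φ x, f⟩| ≤ ‖f‖ and |⟨Ψ x, g⟩| ≤ ‖g‖. -/
theorem lintegral_symbol_mul_le (hΦ : IsBesselFamily Φ μ C) (hΨ : IsBesselFamily Ψ μ C)
    (hΦ1 : ∀ x, ‖Φ x‖ ≤ 1) (hΨ1 : ∀ x, ‖Ψ x‖ ≤ 1) (hp : 1 ≤ p)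
    (hm : AEStronglyMeasurable m μ) (f g : H) :
    ∫⁻ x, ‖m x * inner ℂ (Φ x) f * (starRingEnd ℂ) (inner ℂ (Ψ x) g)‖ₑ ∂μ ≤
      (C + ∫⁻ x, ‖m x‖ₑ ^ p ∂μ) * (‖f‖ₑ * ‖g‖ₑ) := by
  have hpt : ∀ x, ‖m x * inner ℂ (Φ x) f * (starRingEnd ℂ) (inner ℂ (Ψ x) g)‖ₑ ≤
      ‖(inner ℂ (Φ x) f : ℂ)‖ₑ * ‖(inner ℂ (Ψ x) g : ℂ)‖ₑ + ‖m x‖ₑ ^ p * (‖f‖ₑ * ‖g‖ₑ) := by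
    intro x
    have h1 : ‖m x‖ₑ ≤ 1 + ‖m x‖ₑ ^ p := by
      rcases le_total ‖m x‖ₑ 1 with h | h
      · exact h.trans le_self_add
      · calc ‖m x‖ₑ = ‖m x‖ₑ ^ (1 : ℝ) := (ENNReal.rpow_one _).symm
          _ ≤ ‖m x‖ₑ ^ p := ENNReal.rpow_le_rpow_of_exponent_le h hp
          _ ≤ _ := le_add_self
    rw [enorm_mul, enorm_mul, RCLike.enorm_conj, mul_assoc]
    refine (mul_le_mul_left h1 _).trans ?_
    rw [add_mul, one_mul]
    gcongr
    · exact enorm_inner_le_of_norm_le_one (hΦ1 x) f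
    · exact enorm_inner_le_of_norm_le_one (hΨ1 x) g
  refine (lintegral_mono hpt).trans ?_
  have hmeas : Measurable fun x => ‖(inner ℂ (Φ x) f : ℂ)‖ₑ * ‖(inner ℂ (Ψ x) g : ℂ)‖ₑ :=
    (hΦ.measurable_inner f).enorm.mul (hΨ.measurable_inner g).enorm
  rw [lintegral_add_left hmeas, lintegral_mul_const'' _ (hm.enorm.pow_const p), add_mul]
  gcongr
  exact hΦ.lintegral_mul_le hΨ f g

theorem integrable_symbol_mul (hΦ : IsBesselFamily Φ μ C) (hΨ : IsBesselFamily Ψ μ C)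
    (hΦ1 : ∀ x, ‖Φ x‖ ≤ 1) (hΨ1 : ∀ x, ‖Ψ x‖ ≤ 1) (hp : 1 ≤ p)
    (hm : MemLp m (ENNReal.ofReal p) μ) (f g : H) :
    Integrable (fun x => m x * inner ℂ (Φ x) f * (starRingEnd ℂ) (inner ℂ (Ψ x) g)) μ := by
  refine ⟨(hm.1.mul (hΦ.measurable_inner f).aestronglyMeasurable).mul
    (Complex.continuous_conj.measurable.comp (hΨ.measurable_inner g)).aestronglyMeasurable, ?_⟩
  refine (lintegral_symbol_mul_le hΦ hΨ hΦ1 hΨ1 hp hm.1 f g).trans_lt ?_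
  exact ENNReal.mul_lt_top (ENNReal.add_lt_top.2 ⟨ENNReal.coe_lt_top,
    lintegral_enorm_rpow_lt_top hp hm⟩) (ENNReal.mul_lt_top enorm_lt_top enorm_lt_top)

variable [CompleteSpace H]

theorem exists_localization_operator (hΦ : IsBesselFamily Φ μ C) (hΨ : IsBesselFamily Ψ μ C)
    (hΦ1 : ∀ x, ‖Φ x‖ ≤ 1) (hΨ1 : ∀ x, ‖Ψ x‖ ≤ 1) (hp : 1 ≤ p)
    (hm : MemLp m (ENNReal.ofReal p) μ) :
    ∃ M : H →L[ℂ] H, ∀ f g, inner ℂ g (M f) =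
      ∫ x, m x * inner ℂ (Φ x) f * (starRingEnd ℂ) (inner ℂ (Ψ x) g) ∂μ := by
  have hint := integrable_symbol_mul hΦ hΨ hΦ1 hΨ1 hp hm
  let B : H →ₗ⋆[ℂ] H →ₗ[ℂ] ℂ := LinearMap.mk₂'ₛₗ _ _
    (fun g f => ∫ x, m x * inner ℂ (Φ x) f * (starRingEnd ℂ) (inner ℂ (Ψ x) g) ∂μ)
    (fun g g' f => by
      rw [← integral_add (hint f g) (hint f g')]
      simp only [inner_add_right, map_add, mul_add])
    (fun c g f => by
      rw [smul_eq_mul, ← integral_const_mul]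
      refine integral_congr_ae (ae_of_all _ fun x => ?_)
      simp only [inner_smul_right, map_mul]
      ring)
    (fun g f f' => by
      rw [← integral_add (hint f g) (hint f' g)]
      simp only [inner_add_right, mul_add, add_mul])
    (fun c g f => by
      rw [smul_eq_mul, ← integral_const_mul]
      refine integral_congr_ae (ae_of_all _ fun x => ?_)
      simp only [inner_smul_right, RingHom.id_apply]
      ring)
  set K : ℝ≥0∞ := C + ∫⁻ x, ‖m x‖ₑ ^ p ∂μ
  have hK : K ≠ ∞ := (ENNReal.add_lt_top.2 ⟨ENNReal.coe_lt_top,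
    lintegral_enorm_rpow_lt_top hp hm⟩).ne
  let B' : H →L⋆[ℂ] H →L[ℂ] ℂ := B.mkContinuous₂ K.toReal fun g f => by
    have h := (enorm_integral_le_lintegral_enorm _).trans
      (lintegral_symbol_mul_le hΦ hΨ hΦ1 hΨ1 hp hm.1 f g)
    have h' := ENNReal.toReal_mono (ENNReal.mul_ne_top hK
      (ENNReal.mul_ne_top enorm_ne_top enorm_ne_top)) h
    simp only [ENNReal.toReal_mul, toReal_enorm] at h'
    calc ‖B g f‖ ≤ K.toReal * (‖f‖ * ‖g‖) := h'
      _ = K.toReal * ‖g‖ * ‖f‖ := by ring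
  -- The Riesz representation produces S with ⟨S g, f⟩ = B g f in the convention of `inner`, so the
  -- operator sought is the adjoint of S.
  refine ⟨(InnerProductSpace.continuousLinearMapOfBilin B').adjoint, fun f g => ?_⟩
  rw [ContinuousLinearMap.adjoint_inner_right,
    InnerProductSpace.continuousLinearMapOfBilin_apply]
  rfl

/-- A localization operator with symbol in `L^p` is of Schatten class `S_p`. -/
theorem isSchatten_of_inner_eq_integral (hΦ : IsBesselFamily Φ μ C) (hΨ : IsBesselFamily Ψ μ C)
    (hΦ1 : ∀ x, ‖Φ x‖ ≤ 1) (hΨ1 : ∀ x, ‖Ψ x‖ ≤ 1) (hp : 1 ≤ p)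
    (hm : MemLp m (ENNReal.ofReal p) μ) {M : H →L[ℂ] H} (hM : ∀ f g, inner ℂ g (M f) =
      ∫ x, m x * inner ℂ (Φ x) f * (starRingEnd ℂ) (inner ℂ (Ψ x) g) ∂μ) :
    IsSchatten p M := by
  have hp0 : 0 < p := by linarith
  set K : ℝ≥0∞ := (∫⁻ x, ‖m x‖ₑ ^ p ∂μ) * (C : ℝ≥0∞) ^ (p - 1)
  have hK : K ≠ ∞ := ENNReal.mul_ne_top (lintegral_enorm_rpow_lt_top hp hm).ne
    (ENNReal.rpow_ne_top_of_nonneg (by linarith) ENNReal.coe_ne_top)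
  refine isSchatten_of_sum_inner_rpow_le (K := K.toReal) hp0 fun n e g he hg => ?_
  -- Two properties of these weights are used: mass at most C for each k, giving the Jensen factor
  -- C^(p-1), and pointwise sum at most 1, which merges the n integrals into ∫ |m|^p.
  let w : Fin n → X → ℝ≥0∞ := fun k x =>
    ‖(inner ℂ (Φ x) (e k) : ℂ)‖ₑ * ‖(inner ℂ (Ψ x) (g k) : ℂ)‖ₑ
  have hw : ∀ k, Measurable (w k) := fun k =>
    (hΦ.measurable_inner (e k)).enorm.mul (hΨ.measurable_inner (g k)).enorm
  have hwC : ∀ k, ∫⁻ x, w k x ∂μ ≤ C := fun k => by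
    have h := hΦ.lintegral_mul_le hΨ (e k) (g k)
    rwa [← ofReal_norm (e k), ← ofReal_norm (g k), he.1 k, hg.1 k, ENNReal.ofReal_one, mul_one,
      mul_one] at h
  have hterm : ∀ k, ‖(inner ℂ (g k) (M (e k)) : ℂ)‖ₑ ^ p ≤
      (∫⁻ x, ‖m x‖ₑ ^ p * w k x ∂μ) * (C : ℝ≥0∞) ^ (p - 1) := by
    intro k
    have h1 : ‖(inner ℂ (g k) (M (e k)) : ℂ)‖ₑ ≤ ∫⁻ x, ‖m x‖ₑ * w k x ∂μ := by
      rw [hM]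
      refine (enorm_integral_le_lintegral_enorm _).trans (le_of_eq ?_)
      simp only [w, enorm_mul, RCLike.enorm_conj, mul_assoc]
    refine (ENNReal.rpow_le_rpow h1 hp0.le).trans ?_
    refine (lintegral_mul_rpow_le hm.1.enorm (hw k).aemeasurable hp).trans ?_
    gcongr
    exact hwC k
  have hsum : ∑ k, ‖(inner ℂ (g k) (M (e k)) : ℂ)‖ₑ ^ p ≤ K := by
    refine (Finset.sum_le_sum fun k _ => hterm k).trans ?_
    have hmeas : ∀ k ∈ Finset.univ, AEMeasurable (fun x => ‖m x‖ₑ ^ p * w k x) μ := fun k _ =>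
      (hm.1.enorm.pow_const p).mul (hw k).aemeasurable
    rw [← Finset.sum_mul, ← lintegral_finsetSum' _ hmeas]
    simp only [K]
    gcongr with x
    rw [← Finset.mul_sum]
    exact mul_le_of_le_one_right' (sum_enorm_inner_mul_enorm_inner_le he hg (hΦ1 x) (hΨ1 x))
  have := ENNReal.toReal_mono hK hsum
  rw [ENNReal.toReal_sum fun k _ => ENNReal.rpow_ne_top_of_nonneg hp0.le enorm_ne_top] at this
  simpa [← ENNReal.toReal_rpow] using this

end LocalizationOperator

/-! ### Tensor products of Bessel families -/

section TensorBessel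

/-- Approximate f by a sequence in D: measurability passes to pointwise limits, and the inequality
passes by Fatou. -/
theorem IsBesselFamily.of_dense {H : Type*} [NormedAddCommGroup H] [InnerProductSpace ℂ H]
    {X : Type*} [MeasurableSpace X] {μ : Measure X} {Φ : X → H} {C : ℝ≥0} {D : Set H}
    (hD : Dense D) (hmeas : ∀ f ∈ D, Measurable fun x => (inner ℂ (Φ x) f : ℂ))
    (hle : ∀ f ∈ D, ∫⁻ x, ‖(inner ℂ (Φ x) f : ℂ)‖ₑ ^ 2 ∂μ ≤ C * ‖f‖ₑ ^ 2) :
    IsBesselFamily Φ μ C := by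
  have happrox : ∀ f : H, ∃ z : ℕ → H, (∀ n, z n ∈ D) ∧
      Filter.Tendsto z Filter.atTop (nhds f) := fun f =>
    mem_closure_iff_seq_limit.1 (hD f)
  have hlim : ∀ {f : H} {z : ℕ → H}, Filter.Tendsto z Filter.atTop (nhds f) → ∀ x,
      Filter.Tendsto (fun n => (inner ℂ (Φ x) (z n) : ℂ)) Filter.atTop
        (nhds (inner ℂ (Φ x) f)) := fun hz x =>
    Filter.Tendsto.inner tendsto_const_nhds hz
  refine ⟨fun f => ?_, fun f => ?_⟩
  · obtain ⟨z, hzD, hz⟩ := happrox f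
    exact measurable_of_tendsto_metrizable (fun n => hmeas _ (hzD n))
      (tendsto_pi_nhds.2 fun x => hlim hz x)
  · obtain ⟨z, hzD, hz⟩ := happrox f
    have hpow : Continuous fun t : ℝ≥0∞ => t ^ 2 := ENNReal.continuous_pow 2
    calc ∫⁻ x, ‖(inner ℂ (Φ x) f : ℂ)‖ₑ ^ 2 ∂μ
        = ∫⁻ x, Filter.liminf (fun n => ‖(inner ℂ (Φ x) (z n) : ℂ)‖ₑ ^ 2) Filter.atTop ∂μ := by
          refine lintegral_congr fun x => ?_
          exact ((hpow.tendsto _).comp (hlim hz x).enorm).liminf_eq.symm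
      _ ≤ Filter.liminf (fun n => ∫⁻ x, ‖(inner ℂ (Φ x) (z n) : ℂ)‖ₑ ^ 2 ∂μ) Filter.atTop :=
          lintegral_liminf_le fun n => (hmeas _ (hzD n)).enorm.pow_const 2
      _ ≤ Filter.liminf (fun n => C * ‖z n‖ₑ ^ 2) Filter.atTop :=
          Filter.liminf_le_liminf (Filter.Eventually.of_forall fun n => hle _ (hzD n))
      _ = C * ‖f‖ₑ ^ 2 := by
          refine Filter.Tendsto.liminf_eq ?_
          exact ENNReal.Tendsto.const_mul ((hpow.tendsto _).comp hz.enorm)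
            (Or.inr ENNReal.coe_ne_top)

variable {E F : Type*} [NormedAddCommGroup E] [InnerProductSpace ℂ E]
  [NormedAddCommGroup F] [InnerProductSpace ℂ F]

/-- The tensor lies in a product of finite-dimensional subspaces; expand along an orthonormal basis
of the right one. Squared norms then add up without cross terms. -/
theorem TensorProduct.exists_eq_sum_tmul_orthonormal (z : E ⊗[ℂ] F) :
    ∃ (n : ℕ) (u : Fin n → E) (v : Fin n → F), Orthonormal ℂ v ∧ z = ∑ i, u i ⊗ₜ[ℂ] v i := by
  obtain ⟨E', F', iE', iF', hz⟩ :=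
    TensorProduct.exists_finite_submodule_of_setFinite {z} (Set.finite_singleton z)
  obtain ⟨y, hy⟩ := Set.singleton_subset_iff.mp hz
  let b := stdOrthonormalBasis ℂ F'
  obtain ⟨c, hc⟩ := TensorProduct.eq_repr_basis_right b.toBasis y
  refine ⟨_, fun i => (c i : E), fun i => (b i : F),
    b.orthonormal.comp_linearIsometry F'.subtypeₗᵢ, ?_⟩
  rw [← hy, ← hc, Finsupp.sum_fintype _ _ (by simp), map_sum]
  simp [TensorProduct.mapIncl]

theorem norm_sq_sum_smul_orthonormal {ι : Type*} [Fintype ι] {v : ι → F} (hv : Orthonormal ℂ v)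
    (c : ι → ℂ) : ‖∑ i, c i • v i‖ₑ ^ 2 = ∑ i, ‖c i‖ₑ ^ 2 := by
  have h : ‖∑ i, c i • v i‖ ^ 2 = ∑ i, ‖c i‖ ^ 2 := by
    have := hv.inner_sum c c Finset.univ
    rw [inner_self_eq_norm_sq_to_K] at this
    simp only [RCLike.conj_mul] at this
    exact_mod_cast this
  simp only [← ofReal_norm]
  rw [← ENNReal.ofReal_pow (norm_nonneg _), h, ENNReal.ofReal_sum_of_nonneg fun i _ => by positivity]
  simp [ENNReal.ofReal_pow]

theorem norm_sq_sum_tmul_orthonormal {ι : Type*} [Fintype ι] {v : ι → F} (hv : Orthonormal ℂ v)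
    (u : ι → E) : ‖∑ i, u i ⊗ₜ[ℂ] v i‖ₑ ^ 2 = ∑ i, ‖u i‖ₑ ^ 2 := by
  classical
  have h : ‖∑ i, u i ⊗ₜ[ℂ] v i‖ ^ 2 = ∑ i, ‖u i‖ ^ 2 := by
    have h1 : (inner ℂ (∑ i, u i ⊗ₜ[ℂ] v i) (∑ i, u i ⊗ₜ[ℂ] v i) : ℂ) =
        ∑ i, inner ℂ (u i) (u i) := by
      simp [sum_inner, inner_sum, orthonormal_iff_ite.1 hv]
    have := (inner_self_eq_norm_sq_to_K (𝕜 := ℂ) (∑ i, u i ⊗ₜ[ℂ] v i)).symm.trans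
      (h1.trans (Finset.sum_congr rfl fun i _ => inner_self_eq_norm_sq_to_K (u i)))
    exact_mod_cast this
  simp only [← ofReal_norm]
  rw [← ENNReal.ofReal_pow (norm_nonneg _), h, ENNReal.ofReal_sum_of_nonneg fun i _ => by positivity]
  simp [ENNReal.ofReal_pow]

/-- The tensor product of two Bessel families is a Bessel family. -/
theorem IsBesselFamily.tensor {X Y : Type*} [MeasurableSpace X] [MeasurableSpace Y]
    {μ : Measure X} {ν : Measure Y} [SFinite ν] {κ : X → E} {l : Y → F} {C D : ℝ≥0}
    (hκ : IsBesselFamily κ μ C) (hl : IsBesselFamily l ν D) :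
    IsBesselFamily (fun x : X × Y =>
      ((κ x.1 ⊗ₜ[ℂ] l x.2 : E ⊗[ℂ] F) : UniformSpace.Completion (E ⊗[ℂ] F)))
      (μ.prod ν) (C * D) := by
  have hexp : ∀ {n : ℕ} (u : Fin n → E) (v : Fin n → F) (x : X × Y),
      (inner ℂ ((κ x.1 ⊗ₜ[ℂ] l x.2 : E ⊗[ℂ] F) : UniformSpace.Completion (E ⊗[ℂ] F))
        ((∑ i, u i ⊗ₜ[ℂ] v i : E ⊗[ℂ] F) : UniformSpace.Completion (E ⊗[ℂ] F)) : ℂ) =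
      ∑ i, inner ℂ (κ x.1) (u i) * inner ℂ (l x.2) (v i) := by
    intro n u v x
    rw [UniformSpace.Completion.inner_coe, inner_sum]
    simp
  have hmeas : ∀ {n : ℕ} (u : Fin n → E) (v : Fin n → F), Measurable fun x : X × Y =>
      ∑ i, (inner ℂ (κ x.1) (u i) * inner ℂ (l x.2) (v i) : ℂ) := fun u v =>
    Finset.measurable_fun_sum _ fun i _ => ((hκ.measurable_inner (u i)).comp measurable_fst).mul
      ((hl.measurable_inner (v i)).comp measurable_snd)
  refine IsBesselFamily.of_dense UniformSpace.Completion.denseRange_coe ?_ ?_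
  · rintro _ ⟨z, rfl⟩
    obtain ⟨n, u, v, hv, rfl⟩ := TensorProduct.exists_eq_sum_tmul_orthonormal z
    simp only [hexp]
    exact hmeas u v
  · rintro _ ⟨z, rfl⟩
    obtain ⟨n, u, v, hv, rfl⟩ := TensorProduct.exists_eq_sum_tmul_orthonormal z
    simp only [hexp]
    rw [lintegral_prod _ ((hmeas u v).enorm.pow_const 2).aemeasurable]
    have hnorm : ‖((∑ i, u i ⊗ₜ[ℂ] v i : E ⊗[ℂ] F) : UniformSpace.Completion (E ⊗[ℂ] F))‖ₑ ^ 2 =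
        ∑ i, ‖u i‖ₑ ^ 2 := by
      rw [← norm_sq_sum_tmul_orthonormal hv, ← ofReal_norm, UniformSpace.Completion.norm_coe,
        ofReal_norm]
    -- For fixed x the sum is the coefficient of l y against the single vector ∑ ⟨κ x, u i⟩ v i. The
    -- Bessel inequality for l and Pythagoras reduce the rest to the one for κ.
    calc ∫⁻ x, ∫⁻ y, ‖∑ i, (inner ℂ (κ x) (u i) * inner ℂ (l y) (v i) : ℂ)‖ₑ ^ 2 ∂ν ∂μ
        = ∫⁻ x, ∫⁻ y, ‖(inner ℂ (l y) (∑ i, (inner ℂ (κ x) (u i) : ℂ) • v i) : ℂ)‖ₑ ^ 2 ∂ν ∂μ := by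
          simp only [inner_sum, inner_smul_right]
      _ ≤ ∫⁻ x, D * ∑ i, ‖(inner ℂ (κ x) (u i) : ℂ)‖ₑ ^ 2 ∂μ := by
          refine lintegral_mono fun x => ?_
          rw [← norm_sq_sum_smul_orthonormal hv]
          exact hl.lintegral_le _
      _ = D * ∑ i, ∫⁻ x, ‖(inner ℂ (κ x) (u i) : ℂ)‖ₑ ^ 2 ∂μ := by
          rw [lintegral_const_mul' _ _ ENNReal.coe_ne_top, lintegral_finsetSum]
          exact fun i _ => (hκ.measurable_inner (u i)).enorm.pow_const 2
      _ ≤ D * ∑ i, C * ‖u i‖ₑ ^ 2 := by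
          gcongr
          exact hκ.lintegral_le _
      _ = _ := by
          rw [← Finset.mul_sum, hnorm, ENNReal.coe_mul]
          ring

end TensorBessel

/-! ### The L² Fourier transform, time-scale shifts and rotations -/

section Fourier

variable {d : ℕ}

theorem L2.enorm_sq_eq_lintegral (f : L2 d) : ‖f‖ₑ ^ 2 = ∫⁻ t, ‖f t‖ₑ ^ 2 := by
  rw [Lp.enorm_def, eLpNorm_eq_lintegral_rpow_enorm_toReal (by simp) (by simp), ← ENNReal.rpow_two,
    ← ENNReal.rpow_mul]
  simp

/-- On `L¹ ∩ L²` the `L²` Fourier transform is given by the Fourier integral. -/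
theorem L2.fourier_ae_eq_of_integrable (f : L2 d) (hf : Integrable f) :
    (𝓕 f : L2 d) =ᵐ[volume] 𝓕 (f : Eucl d → ℂ) := by
  have hcont : Continuous (𝓕 (f : Eucl d → ℂ)) :=
    VectorFourier.fourierIntegral_continuous Real.continuous_fourierChar
      (innerSL ℝ).continuous₂ hf
  -- Both functions are compared against smooth compactly supported test functions: the
  -- distributional definition moves 𝓕 onto the test function, and the multiplication formula for L¹
  -- moves it back onto f.
  refine ae_eq_of_integral_contDiff_smul_eq ((Lp.memLp _).locallyIntegrable one_le_two)
    hcont.locallyIntegrable fun g hg hgc => ?_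
  have hg₁ : HasCompactSupport (Complex.ofRealCLM ∘ g) := hgc.comp_left rfl
  have hg₂ : ContDiff ℝ (⊤ : ℕ∞) (Complex.ofRealCLM ∘ g) := by fun_prop
  let G : SchwartzMap (Eucl d) ℂ := hg₁.toSchwartzMap hg₂
  have hG : ∀ x, G x = g x := fun x => rfl
  have h1 := congrArg (fun T => T G) (Lp.fourier_toTemperedDistribution_eq f)
  simp only [TemperedDistribution.fourier_apply, Lp.toTemperedDistribution_apply] at h1
  have h2 : ∫ x, (𝓕 G) x • f x = ∫ x, G x • 𝓕 (f : Eucl d → ℂ) x := by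
    have := VectorFourier.integral_fourierIntegral_smul_eq_flip (L := innerₗ (Eucl d))
      Real.continuous_fourierChar continuous_inner G.integrable hf (μ := volume) (ν := volume)
    rw [flip_innerₗ] at this
    exact this
  rw [h2] at h1
  simp only [hG] at h1
  exact h1.symm

theorem lintegral_comp_inv_smul_sub (G : Eucl d → ℝ≥0∞) {a : ℝ} (ha : a ≠ 0) (b : Eucl d) :
    ∫⁻ t, G (a⁻¹ • (t - b)) = ENNReal.ofReal (|a| ^ d) * ∫⁻ s, G s := by
  have hinv : a⁻¹ ≠ 0 := inv_ne_zero ha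
  rw [lintegral_sub_right_eq_self (fun t => G (a⁻¹ • t)) b]
  have he := (Homeomorph.smulOfNeZero (α := Eucl d) a⁻¹ hinv).measurableEmbedding
  have h := he.lintegral_map (μ := volume) G
  have hm : Measure.map (Homeomorph.smulOfNeZero (α := Eucl d) a⁻¹ hinv) volume
      = ENNReal.ofReal |(a⁻¹ ^ Module.finrank ℝ (Eucl d))⁻¹| • volume :=
    Measure.map_addHaar_smul volume hinv
  rw [hm, lintegral_smul_measure, finrank_euclideanSpace_fin] at h
  rw [show (|a| ^ d) = |(a⁻¹ ^ d)⁻¹| by simp, ← smul_eq_mul, h]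
  rfl

/-- Lets almost everywhere identities between L² representatives be composed with the affine
substitution. -/
theorem quasiMeasurePreserving_inv_smul_sub {a : ℝ} (ha : a ≠ 0) (b : Eucl d) :
    Measure.QuasiMeasurePreserving (fun t : Eucl d => a⁻¹ • (t - b)) volume volume := by
  refine ⟨by fun_prop, ?_⟩
  refine Measure.AbsolutelyContinuous.mk fun s hs h0 => ?_
  rw [Measure.map_apply (by fun_prop) hs]
  have := lintegral_comp_inv_smul_sub (s.indicator 1) ha b
  rw [lintegral_indicator_one hs, h0, mul_zero] at this
  rw [← lintegral_indicator_one (hs.preimage (by fun_prop))]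
  exact this

theorem coeFn_timeScaleShift (x : TimeScale d) (g : L2 d) :
    timeScaleShift x g =ᵐ[volume] fun t : Eucl d =>
      ((|(x.2 : ℝ)| ^ (-(d : ℝ) / 2) : ℝ) : ℂ) * g ((x.2 : ℝ)⁻¹ • (t - x.1)) :=
  MemLp.coeFn_toLp _

theorem timeScaleShift_sub (x : TimeScale d) (f g : L2 d) :
    timeScaleShift x (f - g) = timeScaleShift x f - timeScaleShift x g := by
  refine Lp.ext ?_
  filter_upwards [coeFn_timeScaleShift x (f - g), coeFn_timeScaleShift x f,
    coeFn_timeScaleShift x g, Lp.coeFn_sub (timeScaleShift x f) (timeScaleShift x g),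
    (quasiMeasurePreserving_inv_smul_sub x.2.2 x.1).ae (Lp.coeFn_sub f g)] with t h1 h2 h3 h4 h5
  rw [h1, h4, Pi.sub_apply, h2, h3, h5, Pi.sub_apply]
  ring

theorem enorm_abs_rpow_sq (a : ℝ) : ‖((|a| ^ (-(d : ℝ) / 2) : ℝ) : ℂ)‖ₑ ^ 2 =
    ENNReal.ofReal ((|a| ^ d)⁻¹) := by
  rw [← ofReal_norm, ← ENNReal.ofReal_pow (norm_nonneg _), Complex.norm_real, Real.norm_eq_abs,
    sq_abs, ← Real.rpow_natCast, ← Real.rpow_mul (abs_nonneg a), ← Real.rpow_natCast _ d,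
    ← Real.rpow_neg (abs_nonneg a)]
  congr 2
  push_cast
  ring

theorem norm_timeScaleShift (x : TimeScale d) (g : L2 d) : ‖timeScaleShift x g‖ = ‖g‖ := by
  have h : ‖timeScaleShift x g‖ₑ ^ 2 = ‖g‖ₑ ^ 2 := by
    have ha : 0 < |(x.2 : ℝ)| ^ d := pow_pos (abs_pos.2 x.2.2) d
    rw [L2.enorm_sq_eq_lintegral, L2.enorm_sq_eq_lintegral]
    calc ∫⁻ t, ‖timeScaleShift x g t‖ₑ ^ 2
        = ∫⁻ t, ENNReal.ofReal ((|(x.2 : ℝ)| ^ d)⁻¹) * ‖g ((x.2 : ℝ)⁻¹ • (t - x.1))‖ₑ ^ 2 := by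
          refine lintegral_congr_ae ?_
          filter_upwards [coeFn_timeScaleShift x g] with t ht
          rw [ht, enorm_mul, mul_pow, enorm_abs_rpow_sq]
      _ = ∫⁻ t, ‖g t‖ₑ ^ 2 := by
          rw [lintegral_const_mul' _ _ ENNReal.ofReal_ne_top,
            lintegral_comp_inv_smul_sub (fun s => ‖g s‖ₑ ^ 2) x.2.2 x.1, ← mul_assoc,
            ← ENNReal.ofReal_mul (by positivity), inv_mul_cancel₀ ha.ne', ENNReal.ofReal_one,
            one_mul]
  rw [← toReal_enorm, ← toReal_enorm]
  exact congrArg _ ((ENNReal.pow_right_strictMono two_ne_zero).injective h)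

theorem continuous_timeScaleShift (x : TimeScale d) :
    Continuous (timeScaleShift x : L2 d → L2 d) := by
  refine (Isometry.of_dist_eq fun f g => ?_).continuous
  rw [dist_eq_norm, dist_eq_norm, ← timeScaleShift_sub, norm_timeScaleShift]

theorem memLp_modulation (b : Eucl d) (g : L2 d) :
    MemLp (fun ω => Real.fourierChar (-inner ℝ b ω) • g ω) 2 volume := by
  have hc : Continuous fun ω : Eucl d => Real.fourierChar (-inner ℝ b ω) :=
    Real.continuous_fourierChar.comp (by fun_prop)
  exact (Lp.memLp g).of_le (hc.aestronglyMeasurable.smul (Lp.aestronglyMeasurable g))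
    (ae_of_all _ fun ω => by rw [Circle.norm_smul])

/-- Multiplication by the character `ω ↦ exp(-2πi⟨b, ω⟩)`. -/
noncomputable def modulation (b : Eucl d) (g : L2 d) : L2 d := (memLp_modulation b g).toLp _

theorem coeFn_modulation (b : Eucl d) (g : L2 d) :
    modulation b g =ᵐ[volume] fun ω => Real.fourierChar (-inner ℝ b ω) • g ω :=
  MemLp.coeFn_toLp _

theorem continuous_modulation (b : Eucl d) : Continuous (modulation b : L2 d → L2 d) := by
  refine (Isometry.of_dist_eq fun f g => ?_).continuous
  rw [dist_eq_norm, dist_eq_norm]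
  have : ‖modulation b f - modulation b g‖ₑ = ‖f - g‖ₑ := by
    rw [Lp.enorm_def, Lp.enorm_def]
    refine eLpNorm_congr_norm_ae ?_
    filter_upwards [coeFn_modulation b f, coeFn_modulation b g, Lp.coeFn_sub f g,
      Lp.coeFn_sub (modulation b f) (modulation b g)] with ω h1 h2 h3 h4
    rw [h4, h3, Pi.sub_apply, Pi.sub_apply, h1, h2, ← smul_sub, Circle.norm_smul]
  rw [← toReal_enorm, this, toReal_enorm]

theorem L2.denseRange_schwartz :
    DenseRange fun f : SchwartzMap (Eucl d) ℂ => (f.toLp 2 volume : L2 d) :=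
  SchwartzMap.denseRange_toLpCLM (p := 2) (μ := volume) ENNReal.ofNat_ne_top

/-- The parameter `(0, a⁻¹)` of the dilation that corresponds to `(b, a)` in the Fourier domain. -/
noncomputable def TimeScale.dual (x : TimeScale d) : TimeScale d :=
  (0, ⟨(x.2 : ℝ)⁻¹, inv_ne_zero x.2.2⟩)

theorem fourier_dilation_translation (f : Eucl d → ℂ) {a : ℝ} (ha : a ≠ 0) (b ω : Eucl d) :
    𝓕 (fun t => ((|a| ^ (-(d : ℝ) / 2) : ℝ) : ℂ) * f (a⁻¹ • (t - b))) ω =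
      Real.fourierChar (-inner ℝ b ω) •
        (((|a⁻¹| ^ (-(d : ℝ) / 2) : ℝ) : ℂ) * 𝓕 f (a • ω)) := by
  have hd : 0 < |a| ^ d := pow_pos (abs_pos.2 ha) d
  rw [Real.fourier_eq, Real.fourier_eq]
  let G : Eucl d → ℂ := fun s => Real.fourierChar (-inner ℝ (a • s + b) ω) •
    (((|a| ^ (-(d : ℝ) / 2) : ℝ) : ℂ) * f s)
  have hG : ∀ s, G s = (Real.fourierChar (-inner ℝ b ω) : ℂ) *
      ((|a| ^ (-(d : ℝ) / 2) : ℝ) : ℂ) * (Real.fourierChar (-inner ℝ s (a • ω)) • f s) := by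
    intro s
    simp only [G, inner_add_left, inner_smul_left, inner_smul_right, neg_add,
      AddChar.map_add_eq_mul, Circle.smul_def, smul_eq_mul, Circle.coe_mul, conj_trivial]
    ring
  have hpow : |a| ^ d * |a| ^ (-(d : ℝ) / 2) = |a⁻¹| ^ (-(d : ℝ) / 2) := by
    rw [abs_inv, Real.inv_rpow (abs_nonneg a), ← Real.rpow_neg (abs_nonneg a),
      ← Real.rpow_natCast, ← Real.rpow_add (abs_pos.2 ha)]
    congr 1
    ring
  calc ∫ t, Real.fourierChar (-inner ℝ t ω) •
        (((|a| ^ (-(d : ℝ) / 2) : ℝ) : ℂ) * f (a⁻¹ • (t - b)))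
      = ∫ t, G (a⁻¹ • (t - b)) := by
        refine integral_congr_ae (ae_of_all _ fun t => ?_)
        simp only [G]
        rw [smul_smul, mul_inv_cancel₀ ha, one_smul, sub_add_cancel]
    _ = (|a| ^ d) • ∫ s, G s := by
        rw [integral_sub_right_eq_self (fun t => G (a⁻¹ • t)) b, Measure.integral_comp_smul]
        simp
    _ = _ := by
        simp only [hG]
        rw [integral_const_mul, Circle.smul_def, Complex.real_smul, smul_eq_mul, ← hpow,
          Complex.ofReal_mul]
        ring

theorem coeFn_fourier_toLp (f : SchwartzMap (Eucl d) ℂ) :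
    (𝓕 (f.toLp 2 volume : L2 d) : L2 d) =ᵐ[volume] 𝓕 (f : Eucl d → ℂ) := by
  rw [SchwartzMap.toLp_fourier_eq, ← SchwartzMap.fourier_coe]
  exact SchwartzMap.coeFn_toLp _ _ _

/-- A shifted Schwartz function is integrable, so its L² transform is the Fourier integral and the
classical formula applies. Density and continuity extend the identity to L². -/
theorem fourier_timeScaleShift_toLp (x : TimeScale d) (f : SchwartzMap (Eucl d) ℂ) :
    (𝓕 (timeScaleShift x (f.toLp 2 volume : L2 d)) : L2 d) =
      modulation x.1 (timeScaleShift x.dual (𝓕 (f.toLp 2 volume : L2 d) : L2 d)) := by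
  obtain ⟨b, a, ha⟩ := x
  have hfa := f.coeFn_toLp 2 (volume : Measure (Eucl d))
  have hS : timeScaleShift (b, ⟨a, ha⟩) (f.toLp 2 volume : L2 d) =ᵐ[volume] fun t =>
      ((|a| ^ (-(d : ℝ) / 2) : ℝ) : ℂ) * f (a⁻¹ • (t - b)) := by
    filter_upwards [coeFn_timeScaleShift (b, ⟨a, ha⟩) (f.toLp 2 volume : L2 d),
      (quasiMeasurePreserving_inv_smul_sub ha b).ae hfa] with t h1 h2
    rw [h1, h2]
  have hint : Integrable (timeScaleShift (b, ⟨a, ha⟩) (f.toLp 2 volume : L2 d)) := by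
    refine Integrable.congr (Integrable.const_mul ?_ _) hS.symm
    exact ((f.integrable (μ := volume)).comp_smul (inv_ne_zero ha)).comp_sub_right b
  refine Lp.ext ?_
  filter_upwards [L2.fourier_ae_eq_of_integrable _ hint,
    coeFn_modulation b (timeScaleShift (TimeScale.dual (b, ⟨a, ha⟩)) (𝓕 (f.toLp 2 volume : L2 d) : L2 d)),
    coeFn_timeScaleShift (TimeScale.dual (b, ⟨a, ha⟩)) (𝓕 (f.toLp 2 volume : L2 d) : L2 d),
    (quasiMeasurePreserving_inv_smul_sub (inv_ne_zero ha) (0 : Eucl d)).ae (coeFn_fourier_toLp f)]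
    with ω h1 h2 h3 h4
  have h5 : 𝓕 (timeScaleShift (b, ⟨a, ha⟩) (f.toLp 2 volume : L2 d) : Eucl d → ℂ) ω =
      𝓕 (fun t => ((|a| ^ (-(d : ℝ) / 2) : ℝ) : ℂ) * f (a⁻¹ • (t - b))) ω := by
    rw [Real.fourier_eq, Real.fourier_eq]
    refine integral_congr_ae ?_
    filter_upwards [hS] with t ht
    rw [ht]
  rw [sub_zero, inv_inv] at h4
  simp only [TimeScale.dual, sub_zero, inv_inv] at h3
  rw [h1, h5, fourier_dilation_translation _ ha, ← h4, ← h3]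
  exact h2.symm

theorem fourier_timeScaleShift (x : TimeScale d) (g : L2 d) :
    (𝓕 (timeScaleShift x g) : L2 d) = modulation x.1 (timeScaleShift x.dual (𝓕 g)) := by
  have hF : Continuous fun g : L2 d => (𝓕 g : L2 d) := (Lp.fourierTransformₗᵢ _ _).continuous
  refine congrFun (L2.denseRange_schwartz.equalizer (g := fun g : L2 d => 𝓕 (timeScaleShift x g))
    (h := fun g : L2 d => modulation x.1 (timeScaleShift x.dual (𝓕 g))) ?_ ?_ ?_) g
  · exact hF.comp (continuous_timeScaleShift x)
  · exact (continuous_modulation _).comp ((continuous_timeScaleShift _).comp hF)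
  · exact funext (fourier_timeScaleShift_toLp x)

theorem fourier_compMeasurePreserving (R : Eucl d ≃ₗᵢ[ℝ] Eucl d) (g : L2 d) :
    (𝓕 (Lp.compMeasurePreserving R R.measurePreserving g : L2 d) : L2 d) =
      Lp.compMeasurePreserving R R.measurePreserving (𝓕 g : L2 d) := by
  have hiso : Continuous (Lp.compMeasurePreserving R R.measurePreserving : L2 d → L2 d) :=
    (Lp.isometry_compMeasurePreserving _).continuous
  refine congrFun (L2.denseRange_schwartz.equalizer
    (g := fun g : L2 d => 𝓕 (Lp.compMeasurePreserving R R.measurePreserving g : L2 d))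
    (h := fun g : L2 d => Lp.compMeasurePreserving R R.measurePreserving (𝓕 g : L2 d)) ?_ ?_ ?_) g
  · exact (Lp.fourierTransformₗᵢ _ _).continuous.comp hiso
  · exact hiso.comp (Lp.fourierTransformₗᵢ _ _).continuous
  funext f
  have hfa := f.coeFn_toLp 2 (volume : Measure (Eucl d))
  have hS : Lp.compMeasurePreserving R R.measurePreserving (f.toLp 2 volume : L2 d) =ᵐ[volume]
      (f : Eucl d → ℂ) ∘ R := by
    filter_upwards [Lp.coeFn_compMeasurePreserving (f.toLp 2 volume : L2 d) R.measurePreserving,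
      R.measurePreserving.quasiMeasurePreserving.ae hfa] with t h1 h2
    rw [h1, Function.comp_apply, h2, Function.comp_apply]
  have hint : Integrable (Lp.compMeasurePreserving R R.measurePreserving (f.toLp 2 volume : L2 d)) :=
    Integrable.congr (R.measurePreserving.integrable_comp_of_integrable f.integrable) hS.symm
  refine Lp.ext ?_
  filter_upwards [L2.fourier_ae_eq_of_integrable _ hint,
    Lp.coeFn_compMeasurePreserving (𝓕 (f.toLp 2 volume : L2 d) : L2 d) R.measurePreserving,
    R.measurePreserving.quasiMeasurePreserving.ae (coeFn_fourier_toLp f)] with ω h1 h2 h3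
  simp only [Function.comp_apply] at h2 ⊢
  rw [h1, h2, h3, ← Real.fourier_comp_linearIsometry, Real.fourier_eq, Real.fourier_eq]
  refine integral_congr_ae ?_
  filter_upwards [hS] with t ht
  rw [ht]

/-- The Fourier transform of a rotation invariant function is rotation invariant. -/
theorem IsRotationInvariant.fourier {g : L2 d} (hg : IsRotationInvariant g) :
    IsRotationInvariant (𝓕 g : L2 d) := by
  intro R hR
  have h1 : (Lp.compMeasurePreserving R R.measurePreserving g : L2 d) = g :=
    Lp.ext ((Lp.coeFn_compMeasurePreserving g R.measurePreserving).trans (hg R hR))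
  have h2 := fourier_compMeasurePreserving R g
  rw [h1] at h2
  have h3 := Lp.coeFn_compMeasurePreserving (𝓕 g : L2 d) R.measurePreserving
  rw [← h2] at h3
  exact h3.symm

end Fourier

/-! ### Transitivity of rotations on spheres up to sign -/

section Rotations

variable {d : ℕ}

theorem det_reflection_orthogonal_singleton {v : Eucl d} (hv : v ≠ 0) :
    LinearMap.det (((ℝ ∙ v)ᗮ.reflection).toLinearEquiv : Eucl d →ₗ[ℝ] Eucl d) = -1 := by
  have h := Submodule.det_reflection (ℝ ∙ v)ᗮ
  rw [Submodule.orthogonal_orthogonal, finrank_span_singleton hv, pow_one] at h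
  exact h

theorem exists_ne_zero_mem_orthogonal_singleton (hd : 2 ≤ d) (y : Eucl d) :
    ∃ v : Eucl d, v ≠ 0 ∧ y ∈ (ℝ ∙ v)ᗮ := by
  have hne : (ℝ ∙ y)ᗮ ≠ ⊥ := by
    intro h
    have h1 := Submodule.finrank_add_finrank_orthogonal (ℝ ∙ y)
    rw [h, finrank_bot, finrank_euclideanSpace_fin] at h1
    have h2 := finrank_span_le_card (R := ℝ) ({y} : Set (Eucl d))
    simp only [Set.toFinset_singleton, Finset.card_singleton] at h2
    omega
  obtain ⟨v, hv, hv0⟩ := Submodule.exists_mem_ne_zero_of_ne_bot hne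
  refine ⟨v, hv0, ?_⟩
  rw [Submodule.mem_orthogonal_singleton_iff_inner_left, real_inner_comm]
  exact Submodule.mem_orthogonal_singleton_iff_inner_left.1 hv

/-- Together with `-1`, the rotations act transitively on spheres, in every dimension. -/
theorem exists_rotation_apply_eq_or_neg (hd : 1 ≤ d) {x y : Eucl d} (hxy : ‖x‖ = ‖y‖) :
    ∃ R : Eucl d ≃ₗᵢ[ℝ] Eucl d,
      LinearMap.det (R.toLinearEquiv : Eucl d →ₗ[ℝ] Eucl d) = 1 ∧ (R x = y ∨ R x = -y) := by
  rcases eq_or_ne x y with rfl | hne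
  · exact ⟨LinearIsometryEquiv.refl ℝ _, LinearMap.det_id, Or.inl rfl⟩
  -- This reflection takes x to y but has determinant -1. For d ≥ 2 a second reflection fixing y
  -- corrects the sign. For d = 1 there is no such reflection; composing with -1, of determinant -1
  -- there, corrects it at the price of reaching -y.
  set R₀ := (ℝ ∙ (x - y))ᗮ.reflection
  have hR₀ : R₀ x = y := Submodule.reflection_sub hxy
  have hdet₀ := det_reflection_orthogonal_singleton (sub_ne_zero.2 hne)
  rcases hd.eq_or_lt with rfl | hd2
  · refine ⟨R₀.trans (LinearIsometryEquiv.neg ℝ), ?_, Or.inr ?_⟩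
    · have : ((R₀.trans (LinearIsometryEquiv.neg ℝ)).toLinearEquiv : Eucl 1 →ₗ[ℝ] Eucl 1) =
          (-1 : ℝ) • (R₀.toLinearEquiv : Eucl 1 →ₗ[ℝ] Eucl 1) := by
        ext1 t
        simp
      rw [this, LinearMap.det_smul, hdet₀]
      simp
    · simp [hR₀]
  · obtain ⟨v, hv0, hv⟩ := exists_ne_zero_mem_orthogonal_singleton hd2 y
    refine ⟨R₀.trans (ℝ ∙ v)ᗮ.reflection, ?_, Or.inl ?_⟩
    · have : ((R₀.trans (ℝ ∙ v)ᗮ.reflection).toLinearEquiv : Eucl d →ₗ[ℝ] Eucl d) =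
          (((ℝ ∙ v)ᗮ.reflection).toLinearEquiv : Eucl d →ₗ[ℝ] Eucl d) ∘ₗ
            (R₀.toLinearEquiv : Eucl d →ₗ[ℝ] Eucl d) := rfl
      rw [this, LinearMap.det_comp, hdet₀, det_reflection_orthogonal_singleton hv0]
      norm_num
    · rw [LinearIsometryEquiv.trans_apply, hR₀]
      exact Submodule.reflection_mem_subspace_eq_self hv

end Rotations

/-! ### Rigidity of homogeneous rotation invariant functions -/

section Ergodic

variable {d : ℕ} {F : Eucl d → ℝ≥0∞}

theorem setLIntegral_closedBall_rotation {R : Eucl d ≃ₗᵢ[ℝ] Eucl d}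
    (hF : (fun t => F (R t)) =ᵐ[volume] F) (x : Eucl d) (r : ℝ) :
    ∫⁻ y in Metric.closedBall (R x) r, F y = ∫⁻ y in Metric.closedBall x r, F y := by
  have hpre : R ⁻¹' Metric.closedBall (R x) r = Metric.closedBall x r := by
    ext t
    simp
  rw [← R.measurePreserving.setLIntegral_comp_preimage_emb
    R.toHomeomorph.measurableEmbedding F, hpre]
  exact lintegral_congr_ae (ae_restrict_of_ae hF)

theorem setLIntegral_closedBall_smul (hF : ∀ c : ℝ, c ≠ 0 → ∀ t, F (c • t) = F t) {c : ℝ}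
    (hc : c ≠ 0) (x : Eucl d) (r : ℝ) :
    ∫⁻ y in Metric.closedBall (c • x) (|c| * r), F y =
      ENNReal.ofReal (|c| ^ d) * ∫⁻ y in Metric.closedBall x r, F y := by
  rw [← lintegral_indicator Metric.isClosed_closedBall.measurableSet,
    ← lintegral_indicator Metric.isClosed_closedBall.measurableSet,
    ← lintegral_comp_inv_smul_sub _ hc 0]
  refine lintegral_congr fun t => ?_
  have hmem : c⁻¹ • (t - 0) ∈ Metric.closedBall x r ↔ t ∈ Metric.closedBall (c • x) (|c| * r) := by
    have h : t - c • x = c • (c⁻¹ • (t - 0) - x) := by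
      rw [sub_zero, smul_sub, smul_smul, mul_inv_cancel₀ hc, one_smul]
    rw [mem_closedBall_iff_norm, mem_closedBall_iff_norm, h, norm_smul, Real.norm_eq_abs,
      mul_le_mul_iff_right₀ (abs_pos.2 hc)]
  rw [sub_zero] at hmem ⊢
  by_cases ht : t ∈ Metric.closedBall (c • x) (|c| * r)
  · rw [Set.indicator_of_mem ht, Set.indicator_of_mem (hmem.2 ht), hF c⁻¹ (inv_ne_zero hc)]
  · rw [Set.indicator_of_notMem ht, Set.indicator_of_notMem (mt hmem.1 ht)]

/-- The mean of `F` over a closed ball. -/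
noncomputable def ballMean (F : Eucl d → ℝ≥0∞) (x : Eucl d) (r : ℝ) : ℝ≥0∞ :=
  (∫⁻ y in Metric.closedBall x r, F y) / volume (Metric.closedBall x r)

theorem ballMean_rotation {R : Eucl d ≃ₗᵢ[ℝ] Eucl d}
    (hF : (fun t => F (R t)) =ᵐ[volume] F) (x : Eucl d) (r : ℝ) :
    ballMean F (R x) r = ballMean F x r := by
  have h := setLIntegral_closedBall_rotation (F := 1) (R := R) (by rfl) x r
  simp only [Pi.one_apply, setLIntegral_one] at h
  rw [ballMean, ballMean, setLIntegral_closedBall_rotation hF, h]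

theorem ballMean_smul (hF : ∀ c : ℝ, c ≠ 0 → ∀ t, F (c • t) = F t) {c : ℝ}
    (hc : c ≠ 0) (x : Eucl d) (r : ℝ) :
    ballMean F (c • x) (|c| * r) = ballMean F x r := by
  have h := setLIntegral_closedBall_smul (F := 1) (by simp) hc x r
  simp only [Pi.one_apply, setLIntegral_one] at h
  have hpos : 0 < |c| ^ d := pow_pos (abs_pos.2 hc) d
  rw [ballMean, ballMean, setLIntegral_closedBall_smul hF hc, h, ENNReal.mul_div_mul_left]
  · exact (ENNReal.ofReal_pos.2 hpos).ne'
  · exact ENNReal.ofReal_ne_top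

/-- The annulus `K⁻¹ < |ω| < K`. -/
noncomputable def annulus (d : ℕ) (K : ℝ) : Set (Eucl d) := {ω | K⁻¹ < ‖ω‖ ∧ ‖ω‖ < K}

theorem isOpen_annulus (K : ℝ) : IsOpen (annulus d K) :=
  (isOpen_lt continuous_const continuous_norm).inter (isOpen_lt continuous_norm continuous_const)

theorem exists_mem_annulus {ω : Eucl d} (hω : ω ≠ 0) : ∃ n : ℕ, ω ∈ annulus d (n + 1) := by
  have hpos : 0 < ‖ω‖ := norm_pos_iff.2 hω
  obtain ⟨n, hn⟩ := exists_nat_gt (max ‖ω‖ ‖ω‖⁻¹)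
  have h1 := (le_max_left _ _).trans_lt hn
  have h2 := (le_max_right _ _).trans_lt hn
  refine ⟨n, ?_, by linarith⟩
  rw [inv_lt_comm₀ (by positivity) hpos]
  linarith

open Filter Topology in
-- Integrability is only known on annuli, so Lebesgue differentiation is applied to each truncation;
-- balls of small radius around a point of an open annulus do not see the truncation.
theorem ae_tendsto_ballMean (hFm : Measurable F)
    (hint : ∀ n : ℕ, ∫⁻ ω in annulus d (n + 1), F ω < ∞) :
    ∀ᵐ ω : Eucl d, ω ≠ 0 → Tendsto (ballMean F ω) (𝓝[>] 0) (𝓝 (F ω)) := by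
  have hn : ∀ n : ℕ, ∀ᵐ ω : Eucl d, ω ∈ annulus d (n + 1) →
      Tendsto (ballMean F ω) (𝓝[>] 0) (𝓝 (F ω)) := by
    intro n
    have hA : MeasurableSet (annulus d (n + 1)) := (isOpen_annulus _).measurableSet
    have hfin : ∫⁻ ω, (annulus d (n + 1)).indicator F ω ≠ ∞ := by
      rw [lintegral_indicator hA]
      exact (hint n).ne
    filter_upwards [VitaliFamily.ae_tendsto_lintegral_div
      (Besicovitch.vitaliFamily (volume : Measure (Eucl d)))
      (hFm.indicator hA).aemeasurable hfin] with ω hω hωA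
    have h1 := hω.comp (Besicovitch.tendsto_filterAt (volume : Measure (Eucl d)) ω)
    rw [Set.indicator_of_mem hωA] at h1
    refine h1.congr' ?_
    obtain ⟨ε, hε, hball⟩ := Metric.isOpen_iff.1 (isOpen_annulus _) ω hωA
    filter_upwards [Ioo_mem_nhdsGT hε] with r hr
    have hsub : Metric.closedBall ω r ⊆ annulus d (n + 1) :=
      (Metric.closedBall_subset_ball hr.2).trans hball
    simp only [Function.comp_apply, ballMean]
    congr 1
    refine setLIntegral_congr_fun Metric.isClosed_closedBall.measurableSet fun y hy => ?_
    exact Set.indicator_of_mem (hsub hy) F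
  filter_upwards [ae_all_iff.2 hn] with ω hω hω0
  obtain ⟨n, hn⟩ := exists_mem_annulus hω0
  exact hω n hn

open Filter Topology in
/-- A function that is homogeneous of degree `0`, rotation invariant almost everywhere and locally
integrable away from the origin is almost everywhere constant. -/
theorem ae_eq_const_of_homogeneous (hd : 1 ≤ d) (hFm : Measurable F)
    (hint : ∀ n : ℕ, ∫⁻ ω in annulus d (n + 1), F ω < ∞)
    (hF : ∀ c : ℝ, c ≠ 0 → ∀ t, F (c • t) = F t)
    (hrot : ∀ R : Eucl d ≃ₗᵢ[ℝ] Eucl d,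
      LinearMap.det (R.toLinearEquiv : Eucl d →ₗ[ℝ] Eucl d) = 1 →
        (fun t => F (R t)) =ᵐ[volume] F) :
    ∃ C : ℝ≥0, ∀ᵐ ω : Eucl d, F ω = C := by
  have : Nonempty (Fin d) := ⟨⟨0, hd⟩⟩
  have : Nontrivial (Eucl d) := inferInstance
  have hne : ∀ᵐ ω : Eucl d, ω ≠ 0 := by
    simp [ae_iff]
  have hlt : ∀ᵐ ω : Eucl d, ω ≠ 0 → F ω < ∞ := by
    have hn : ∀ n : ℕ, ∀ᵐ ω : Eucl d, ω ∈ annulus d (n + 1) → F ω < ∞ := fun n =>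
      (ae_restrict_iff' (isOpen_annulus _).measurableSet).1 (ae_lt_top hFm (hint n).ne)
    filter_upwards [ae_all_iff.2 hn] with ω hω hω0
    obtain ⟨n, hn⟩ := exists_mem_annulus hω0
    exact hω n hn
  obtain ⟨ω₀, h0, hlt0, ht0⟩ := (hne.and (hlt.and (ae_tendsto_ballMean hFm hint))).exists
  lift F ω₀ to ℝ≥0 using (hlt0 h0).ne with C hC
  refine ⟨C, ?_⟩
  filter_upwards [hne, ae_tendsto_ballMean hFm hint] with ω h1 ht1
  have hpos : 0 < ‖ω‖ := norm_pos_iff.2 h1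
  have hpos0 : 0 < ‖ω₀‖ := norm_pos_iff.2 h0
  set c : ℝ := ‖ω‖ / ‖ω₀‖ with hcdef
  have hc : 0 < c := by positivity
  have hnorm : ‖c • ω₀‖ = ‖ω‖ := by
    rw [norm_smul, Real.norm_eq_abs, abs_of_pos hc, hcdef, div_mul_cancel₀ _ hpos0.ne']
  obtain ⟨R, hR, hRω⟩ := exists_rotation_apply_eq_or_neg hd hnorm
  -- The exceptional null set of the invariance depends on R, and R depends on ω, so F cannot be
  -- compared pointwise. Ball means ignore null sets, so they agree exactly for every R. Homogeneity
  -- with factor -1 handles the case R (c • ω₀) = -ω.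
  have hmean : ∀ r, ballMean F ω (c * r) = ballMean F ω₀ r := by
    intro r
    have h2 : ballMean F ω (c * r) = ballMean F (R (c • ω₀)) (c * r) := by
      rcases hRω with h | h
      · rw [h]
      · have h3 := ballMean_smul hF (neg_ne_zero.2 one_ne_zero) ω (c * r)
        rw [abs_neg, abs_one, one_mul, neg_smul, one_smul] at h3
        rw [h, h3]
    rw [h2, ballMean_rotation (hrot R hR)]
    have h4 := ballMean_smul hF hc.ne' ω₀ r
    rwa [abs_of_pos hc] at h4
  have hscale : Tendsto (fun r : ℝ => c * r) (𝓝[>] 0) (𝓝[>] 0) := by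
    refine tendsto_nhdsWithin_of_tendsto_nhds_of_eventually_within _ ?_ ?_
    · have : Tendsto (fun r : ℝ => c * r) (𝓝 0) (𝓝 (c * 0)) :=
        tendsto_const_nhds.mul tendsto_id
      rw [mul_zero] at this
      exact this.mono_left nhdsWithin_le_nhds
    · filter_upwards [self_mem_nhdsWithin] with r hr
      exact mul_pos hc hr
  have h5 := (ht1 h1).comp hscale
  have h6 : (ballMean F ω ∘ fun r => c * r) = ballMean F ω₀ := funext hmean
  rw [h6] at h5
  exact tendsto_nhds_unique h5 (ht0 h0)

end Ergodic

/-! ### The Calderón integral -/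

section Calderon

variable {d : ℕ} {G : Eucl d → ℝ≥0∞}

/-- The Calderón integral `∫ G(a ω) da / |a|`. -/
noncomputable def calderon (G : Eucl d → ℝ≥0∞) (ω : Eucl d) : ℝ≥0∞ :=
  ∫⁻ a : ℝ, ENNReal.ofReal |a|⁻¹ * G (a • ω)

theorem measurable_calderon_integrand (hG : Measurable G) :
    Measurable fun z : Eucl d × ℝ => ENNReal.ofReal |z.2|⁻¹ * G (z.2 • z.1) := by
  have h1 : Measurable fun z : Eucl d × ℝ => ENNReal.ofReal |z.2|⁻¹ := by fun_prop
  have h2 : Measurable fun z : Eucl d × ℝ => z.2 • z.1 := by fun_prop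
  exact h1.mul (hG.comp h2)

theorem measurable_calderon (hG : Measurable G) : Measurable (calderon G) :=
  (measurable_calderon_integrand hG).lintegral_prod_right'

/-- The measure da/|a| is invariant under a ↦ a c. Since a runs over both signs, negative c is
allowed. -/
theorem calderon_smul {c : ℝ} (hc : c ≠ 0) (ω : Eucl d) : calderon G (c • ω) = calderon G ω := by
  have he := (Homeomorph.mulRight₀ c hc).measurableEmbedding
  have h := he.lintegral_map (μ := volume) fun a => ENNReal.ofReal |a|⁻¹ * G (a • ω)
  have hm : Measure.map (Homeomorph.mulRight₀ c hc) volume = ENNReal.ofReal |c⁻¹| • volume :=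
    Real.map_volume_mul_right hc
  rw [hm, lintegral_smul_measure] at h
  have hc1 : ENNReal.ofReal |c| * ENNReal.ofReal |c⁻¹| = 1 := by
    rw [← ENNReal.ofReal_mul (abs_nonneg c), ← abs_mul, mul_inv_cancel₀ hc]
    simp
  calc calderon G (c • ω)
      = ∫⁻ a : ℝ, ENNReal.ofReal |c| * (ENNReal.ofReal |a * c|⁻¹ * G ((a * c) • ω)) := by
        refine lintegral_congr fun a => ?_
        rw [abs_mul, mul_inv, ENNReal.ofReal_mul (by positivity), smul_smul, ← abs_inv c]
        calc ENNReal.ofReal |a|⁻¹ * G ((a * c) • ω)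
            = (ENNReal.ofReal |c| * ENNReal.ofReal |c⁻¹|) *
              (ENNReal.ofReal |a|⁻¹ * G ((a * c) • ω)) := by rw [hc1, one_mul]
          _ = _ := by ring
    _ = ENNReal.ofReal |c| * ∫⁻ a : ℝ, (ENNReal.ofReal |a * c|⁻¹ * G ((a * c) • ω)) :=
        lintegral_const_mul' _ _ ENNReal.ofReal_ne_top
    _ = ENNReal.ofReal |c| * (ENNReal.ofReal |c⁻¹| * calderon G ω) := by
        congr 1
        exact h.symm
    _ = calderon G ω := by rw [← mul_assoc, hc1, one_mul]

/-- For each a ≠ 0 the invariance at a • ω holds for almost every ω; Fubini exchanges the two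
quantifiers, using joint measurability. -/
theorem calderon_rotation (hG : Measurable G) {R : Eucl d ≃ₗᵢ[ℝ] Eucl d}
    (hR : (fun t => G (R t)) =ᵐ[volume] G) :
    (fun ω => calderon G (R ω)) =ᵐ[volume] calderon G := by
  have h1 : ∀ᵐ a : ℝ, ∀ᵐ ω : Eucl d, G (a • R ω) = G (a • ω) := by
    have hne : ∀ᵐ a : ℝ, a ≠ 0 := by simp [ae_iff]
    filter_upwards [hne] with a ha
    have h := (quasiMeasurePreserving_inv_smul_sub (inv_ne_zero ha) (0 : Eucl d)).ae hR
    simpa using h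
  have hms : MeasurableSet {z : Eucl d × ℝ | G (z.2 • R z.1) = G (z.2 • z.1)} := by
    have hRm : Measurable fun z : Eucl d × ℝ => R z.1 :=
      R.continuous.measurable.comp measurable_fst
    exact measurableSet_eq_fun (hG.comp (measurable_snd.smul hRm))
      (hG.comp (measurable_snd.smul measurable_fst))
  have h2 := (Measure.ae_ae_comm (μ := (volume : Measure (Eucl d))) (ν := (volume : Measure ℝ))
    (p := fun ω a => G (a • R ω) = G (a • ω)) hms).2 h1
  filter_upwards [h2] with ω hω
  refine lintegral_congr_ae ?_
  filter_upwards [hω] with a ha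
  rw [ha]

/-- Where the indicator is nonzero, |a| < K‖u‖ and |a|⁻¹ < K/‖u‖. Hence the integral is at most the
interval length 2K‖u‖ times (K/‖u‖)^(d+1). -/
theorem lintegral_annulus_weight_le {K : ℝ} (hK : 0 < K) {u : Eucl d} (hu : u ≠ 0) :
    ∫⁻ a : ℝ, ENNReal.ofReal |a|⁻¹ * (ENNReal.ofReal ((|a| ^ d)⁻¹) *
      (annulus d K).indicator 1 (a⁻¹ • u)) ≤ ENNReal.ofReal (2 * K ^ (d + 2)) / ‖u‖ₑ ^ d := by
  have hupos : 0 < ‖u‖ := norm_pos_iff.2 hu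
  have hpt : ∀ a : ℝ, ENNReal.ofReal |a|⁻¹ * (ENNReal.ofReal ((|a| ^ d)⁻¹) *
      (annulus d K).indicator 1 (a⁻¹ • u)) ≤
      (Set.Ioo (-(K * ‖u‖)) (K * ‖u‖)).indicator
        (fun _ => ENNReal.ofReal ((K / ‖u‖) ^ (d + 1))) a := by
    intro a
    by_cases hmem : a⁻¹ • u ∈ annulus d K
    · obtain ⟨h1, h2⟩ := hmem
      rw [norm_smul, norm_inv, Real.norm_eq_abs] at h1 h2
      have ha : 0 < |a| := by
        by_contra h
        have : |a| = 0 := le_antisymm (not_lt.1 h) (abs_nonneg a)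
        rw [this] at h1
        simp only [inv_zero, zero_mul] at h1
        exact absurd h1 (not_lt.2 (by positivity))
      have h3 : |a| < K * ‖u‖ := by
        rw [inv_mul_eq_div, lt_div_iff₀ ha, inv_mul_eq_div, div_lt_iff₀ hK] at h1
        linarith
      have h4 : |a|⁻¹ ≤ K / ‖u‖ := by
        rw [le_div_iff₀ hupos]
        exact h2.le
      rw [Set.indicator_of_mem (show a⁻¹ • u ∈ annulus d K from ⟨by
        rwa [norm_smul, norm_inv, Real.norm_eq_abs], by
        rwa [norm_smul, norm_inv, Real.norm_eq_abs]⟩),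
        Set.indicator_of_mem (Set.mem_Ioo.2 (abs_lt.1 h3)), Pi.one_apply, mul_one,
        ← ENNReal.ofReal_mul (by positivity)]
      refine ENNReal.ofReal_le_ofReal ?_
      calc |a|⁻¹ * (|a| ^ d)⁻¹ = |a|⁻¹ ^ (d + 1) := by rw [pow_succ', inv_pow]
        _ ≤ _ := by gcongr
    · rw [Set.indicator_of_notMem hmem]
      simp
  refine (lintegral_mono hpt).trans (le_of_eq ?_)
  rw [lintegral_indicator_const measurableSet_Ioo, Real.volume_Ioo,
    ← ENNReal.ofReal_mul (by positivity), ← ofReal_norm, ← ENNReal.ofReal_pow hupos.le,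
    ← ENNReal.ofReal_div_of_pos (by positivity)]
  congr 1
  rw [div_pow, eq_div_iff (pow_pos hupos d).ne']
  field_simp
  ring

/-- Tonelli and the substitution u = a ω move the annulus onto the scale variable; integrating out a
leaves a multiple of the admissibility integral. -/
theorem setLIntegral_annulus_calderon_lt_top (hd : 1 ≤ d) (hG : Measurable G)
    (hint : ∫⁻ ω, G ω / ‖ω‖ₑ ^ d < ∞) {K : ℝ} (hK : 0 < K) :
    ∫⁻ ω in annulus d K, calderon G ω < ∞ := by
  have : Nonempty (Fin d) := ⟨⟨0, hd⟩⟩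
  have hA : MeasurableSet (annulus d K) := (isOpen_annulus K).measurableSet
  have hI : Measurable ((annulus d K).indicator (1 : Eucl d → ℝ≥0∞)) :=
    measurable_one.indicator hA
  have hne : ∀ᵐ ω : Eucl d, ω ≠ 0 := by simp [ae_iff]
  calc ∫⁻ ω in annulus d K, calderon G ω
      = ∫⁻ ω, ∫⁻ a : ℝ, (annulus d K).indicator 1 ω * (ENNReal.ofReal |a|⁻¹ * G (a • ω)) := by
        rw [← lintegral_indicator hA]
        refine lintegral_congr fun ω => ?_
        by_cases hω : ω ∈ annulus d K
        · simp only [Set.indicator_of_mem hω, Pi.one_apply, one_mul, calderon]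
        · simp [Set.indicator_of_notMem hω]
    _ = ∫⁻ a : ℝ, ∫⁻ ω, (annulus d K).indicator 1 ω * (ENNReal.ofReal |a|⁻¹ * G (a • ω)) :=
        lintegral_lintegral_swap
          ((hI.comp measurable_fst).mul (measurable_calderon_integrand hG)).aemeasurable
    _ = ∫⁻ a : ℝ, ∫⁻ u, ENNReal.ofReal |a|⁻¹ * (ENNReal.ofReal ((|a| ^ d)⁻¹) *
          (annulus d K).indicator 1 (a⁻¹ • u)) * G u := by
        have hne' : ∀ᵐ a : ℝ, a ≠ 0 := by simp [ae_iff]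
        refine lintegral_congr_ae ?_
        filter_upwards [hne'] with a ha
        have h := lintegral_comp_inv_smul_sub (fun u => ENNReal.ofReal |a|⁻¹ *
          (ENNReal.ofReal ((|a| ^ d)⁻¹) * (annulus d K).indicator 1 (a⁻¹ • u)) * G u)
          (inv_ne_zero ha) 0
        have hpos : 0 < |a| ^ d := pow_pos (abs_pos.2 ha) d
        have hcan : ENNReal.ofReal (|a| ^ d) * ENNReal.ofReal (|a⁻¹| ^ d) = 1 := by
          rw [← ENNReal.ofReal_mul hpos.le, ← mul_pow, ← abs_mul, mul_inv_cancel₀ ha]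
          simp
        have hcan' : ENNReal.ofReal (|a| ^ d) * ENNReal.ofReal ((|a| ^ d)⁻¹) = 1 := by
          rw [← ENNReal.ofReal_mul hpos.le, mul_inv_cancel₀ hpos.ne', ENNReal.ofReal_one]
        simp only [inv_inv, sub_zero, smul_smul, inv_mul_cancel₀ ha, one_smul] at h
        rw [← one_mul (∫⁻ u, _ * G u), ← hcan, mul_assoc, ← h,
          ← lintegral_const_mul' _ _ ENNReal.ofReal_ne_top]
        refine lintegral_congr fun ω => ?_
        calc (annulus d K).indicator 1 ω * (ENNReal.ofReal |a|⁻¹ * G (a • ω))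
            = (ENNReal.ofReal (|a| ^ d) * ENNReal.ofReal ((|a| ^ d)⁻¹)) *
              ((annulus d K).indicator 1 ω * (ENNReal.ofReal |a|⁻¹ * G (a • ω))) := by
              rw [hcan', one_mul]
          _ = _ := by ring
    _ = ∫⁻ u, ∫⁻ a : ℝ, ENNReal.ofReal |a|⁻¹ * (ENNReal.ofReal ((|a| ^ d)⁻¹) *
          (annulus d K).indicator 1 (a⁻¹ • u)) * G u := by
        refine lintegral_lintegral_swap ?_
        have h1 : Measurable fun z : ℝ × Eucl d => ENNReal.ofReal |z.1|⁻¹ := by fun_prop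
        have h2 : Measurable fun z : ℝ × Eucl d => ENNReal.ofReal ((|z.1| ^ d)⁻¹) := by fun_prop
        have h3 : Measurable fun z : ℝ × Eucl d => z.1⁻¹ • z.2 := by fun_prop
        exact ((h1.mul (h2.mul (hI.comp h3))).mul (hG.comp measurable_snd)).aemeasurable
    _ ≤ ∫⁻ u, ENNReal.ofReal (2 * K ^ (d + 2)) * (G u / ‖u‖ₑ ^ d) := by
        refine lintegral_mono_ae ?_
        filter_upwards [hne] with u hu
        have h1 : Measurable fun a : ℝ => ENNReal.ofReal |a|⁻¹ := by fun_prop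
        have h2 : Measurable fun a : ℝ => ENNReal.ofReal ((|a| ^ d)⁻¹) := by fun_prop
        have h3 : Measurable fun a : ℝ => a⁻¹ • u := by fun_prop
        have h4 : Measurable fun a : ℝ => ENNReal.ofReal |a|⁻¹ * (ENNReal.ofReal ((|a| ^ d)⁻¹) *
            (annulus d K).indicator 1 (a⁻¹ • u)) := h1.mul (h2.mul (hI.comp h3))
        rw [lintegral_mul_const _ h4]
        refine (mul_le_mul_left (lintegral_annulus_weight_le hK hu) _).trans (le_of_eq ?_)
        rw [div_eq_mul_inv, div_eq_mul_inv]
        ring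
    _ = ENNReal.ofReal (2 * K ^ (d + 2)) * ∫⁻ u, (G u / ‖u‖ₑ ^ d) :=
        lintegral_const_mul' _ _ ENNReal.ofReal_ne_top
    _ < ∞ := ENNReal.mul_lt_top ENNReal.ofReal_lt_top hint

/-- The Calderón integral of an admissible rotation invariant weight is constant. -/
theorem calderon_ae_eq_const (hd : 1 ≤ d) (hG : Measurable G)
    (hint : ∫⁻ ω, G ω / ‖ω‖ₑ ^ d < ∞)
    (hrot : ∀ R : Eucl d ≃ₗᵢ[ℝ] Eucl d,
      LinearMap.det (R.toLinearEquiv : Eucl d →ₗ[ℝ] Eucl d) = 1 →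
        (fun t => G (R t)) =ᵐ[volume] G) :
    ∃ C : ℝ≥0, ∀ᵐ ω : Eucl d, calderon G ω = C :=
  ae_eq_const_of_homogeneous hd (measurable_calderon hG)
    (fun n => setLIntegral_annulus_calderon_lt_top hd hG hint (by positivity))
    (fun _ hc t => calderon_smul hc t) fun R hR => calderon_rotation hG (hrot R hR)

end Calderon

/-! ### The Bessel inequality for wavelet shifts -/

section WaveletBessel

variable {d : ℕ}

/-- Written as an integral over t, the coefficient has an integrand jointly measurable in the
parameter and t. -/
theorem measurable_inner_timeScaleShift (φ f : L2 d) :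
    Measurable fun x : TimeScale d => (inner ℂ (timeScaleShift x φ) f : ℂ) := by
  have hrep : ∀ x : TimeScale d, (inner ℂ (timeScaleShift x φ) f : ℂ) =
      ∫ t, f t * (starRingEnd ℂ) (((|(x.2 : ℝ)| ^ (-(d : ℝ) / 2) : ℝ) : ℂ) *
        φ ((x.2 : ℝ)⁻¹ • (t - x.1))) := by
    intro x
    rw [L2.inner_def]
    refine integral_congr_ae ?_
    filter_upwards [coeFn_timeScaleShift x φ] with t ht
    rw [ht, RCLike.inner_apply]
  simp only [hrep]
  have hφ : Measurable φ := (Lp.stronglyMeasurable φ).measurable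
  have hf : Measurable f := (Lp.stronglyMeasurable f).measurable
  have h1 : Measurable fun z : TimeScale d × Eucl d =>
      ((|(z.1.2 : ℝ)| ^ (-(d : ℝ) / 2) : ℝ) : ℂ) := by fun_prop
  have h2 : Measurable fun z : TimeScale d × Eucl d => (z.1.2 : ℝ)⁻¹ • (z.2 - z.1.1) := by
    fun_prop
  have h3 : Measurable fun z : TimeScale d × Eucl d => f z.2 *
      (starRingEnd ℂ) (((|(z.1.2 : ℝ)| ^ (-(d : ℝ) / 2) : ℝ) : ℂ) *
        φ ((z.1.2 : ℝ)⁻¹ • (z.2 - z.1.1))) :=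
    (hf.comp measurable_snd).mul
      (Complex.continuous_conj.measurable.comp (h1.mul (hφ.comp h2)))
  exact h3.stronglyMeasurable.integral_prod_right'.measurable

/-- Plancherel for functions in `L¹`: the inequality is trivial when the function is not in
`L²`. -/
theorem lintegral_enorm_fourier_sq_le (h : Eucl d → ℂ) (hh : Integrable h) :
    ∫⁻ b, ‖𝓕 h b‖ₑ ^ 2 ≤ ∫⁻ ω, ‖h ω‖ₑ ^ 2 := by
  rcases eq_or_ne (∫⁻ ω, ‖h ω‖ₑ ^ 2) ∞ with htop | htop
  · rw [htop]
    exact le_top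
  have hmem : MemLp h 2 := by
    refine ⟨hh.1, ?_⟩
    refine (eLpNorm_lt_top_iff_lintegral_rpow_enorm_lt_top (by simp) (by simp)).2 ?_
    simpa using htop.lt_top
  let u : L2 d := hmem.toLp h
  have hu : u =ᵐ[volume] h := hmem.coeFn_toLp
  have huh : 𝓕 (u : Eucl d → ℂ) = 𝓕 h := by
    funext b
    rw [Real.fourier_eq, Real.fourier_eq]
    refine integral_congr_ae ?_
    filter_upwards [hu] with ω hω
    rw [hω]
  have h1 := L2.fourier_ae_eq_of_integrable u (hh.congr hu.symm)
  rw [huh] at h1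
  refine le_of_eq ?_
  calc ∫⁻ b, ‖𝓕 h b‖ₑ ^ 2 = ∫⁻ b, ‖(𝓕 u : L2 d) b‖ₑ ^ 2 := by
        refine lintegral_congr_ae ?_
        filter_upwards [h1] with b hb
        rw [hb]
    _ = ‖u‖ₑ ^ 2 := by
        rw [← L2.enorm_sq_eq_lintegral, ← ofReal_norm, Lp.norm_fourier_eq, ofReal_norm]
    _ = ∫⁻ ω, ‖h ω‖ₑ ^ 2 := by
        rw [L2.enorm_sq_eq_lintegral]
        refine lintegral_congr_ae ?_
        filter_upwards [hu] with ω hω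
        rw [hω]

/-- For a fixed scale, the wavelet transform is the Fourier transform of
`ω ↦ |a|^(d/2) φ̂(a ω) conj (f̂ ω)`, up to complex conjugation. -/
theorem lintegral_translation_inner_sq_le (φ f : L2 d) (a : {a : ℝ // a ≠ 0}) :
    ∫⁻ b, ‖(inner ℂ (timeScaleShift (b, a) φ) f : ℂ)‖ₑ ^ 2 ≤
      ENNReal.ofReal (|(a : ℝ)| ^ d) *
        ∫⁻ ω, ‖(𝓕 φ : L2 d) ((a : ℝ) • ω)‖ₑ ^ 2 * ‖(𝓕 f : L2 d) ω‖ₑ ^ 2 := by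
  let v : L2 d := timeScaleShift (TimeScale.dual (0, a)) (𝓕 φ : L2 d)
  let h : Eucl d → ℂ := fun ω => v ω * (starRingEnd ℂ) ((𝓕 f : L2 d) ω)
  have hh : Integrable h := by
    have := L2.integrable_inner (𝕜 := ℂ) (𝓕 f : L2 d) v
    simpa only [RCLike.inner_apply] using this
  have hW : ∀ b, ‖(inner ℂ (timeScaleShift (b, a) φ) f : ℂ)‖ₑ = ‖𝓕 h b‖ₑ := by
    intro b
    have h1 : (inner ℂ f (timeScaleShift (b, a) φ) : ℂ) = 𝓕 h b := by
      rw [← Lp.inner_fourier_eq, fourier_timeScaleShift, L2.inner_def, Real.fourier_eq]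
      refine integral_congr_ae ?_
      filter_upwards [coeFn_modulation b v] with ω hω
      have hω' : modulation ((b, a) : TimeScale d).1
          (timeScaleShift (TimeScale.dual ((b, a) : TimeScale d)) (𝓕 φ : L2 d)) ω =
          Real.fourierChar (-inner ℝ b ω) • v ω := hω
      rw [RCLike.inner_apply, hω', real_inner_comm, smul_mul_assoc]
    rw [← h1, ← inner_conj_symm, RCLike.enorm_conj]
  simp only [hW]
  refine (lintegral_enorm_fourier_sq_le h hh).trans (le_of_eq ?_)
  rw [← lintegral_const_mul' _ _ ENNReal.ofReal_ne_top]
  refine lintegral_congr_ae ?_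
  filter_upwards [coeFn_timeScaleShift (TimeScale.dual (0, a)) (𝓕 φ : L2 d)] with ω hω
  have hω' : v ω = ((|(a : ℝ)⁻¹| ^ (-(d : ℝ) / 2) : ℝ) : ℂ) *
      (𝓕 φ : L2 d) (((a : ℝ)⁻¹)⁻¹ • (ω - 0)) := hω
  simp only [h]
  rw [enorm_mul, RCLike.enorm_conj, mul_pow, hω', enorm_mul, mul_pow, enorm_abs_rpow_sq, inv_inv,
    sub_zero, mul_assoc, abs_inv, inv_pow, inv_inv]

theorem sigmaFinite_comap_val : SigmaFinite
    (Measure.comap Subtype.val (volume : Measure ℝ) : Measure {a : ℝ // a ≠ 0}) := by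
  have he : MeasurableEmbedding (Subtype.val : {a : ℝ // a ≠ 0} → ℝ) :=
    MeasurableEmbedding.subtype_coe (measurableSet_singleton (0 : ℝ)).compl
  refine SigmaFinite.of_map _ he.measurable.aemeasurable ?_
  rw [he.map_comap]
  infer_instance

theorem sFinite_timeScaleMeasure : SFinite (timeScaleMeasure d) := by
  have := sigmaFinite_comap_val
  unfold timeScaleMeasure
  infer_instance

theorem lintegral_timeScaleMeasure {g : TimeScale d → ℝ≥0∞} (hg : Measurable g) :
    ∫⁻ x, g x ∂timeScaleMeasure d =
      ∫⁻ a : {a : ℝ // a ≠ 0}, ENNReal.ofReal (1 / |(a : ℝ)| ^ (d + 1)) * (∫⁻ b, g (b, a))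
        ∂(Measure.comap Subtype.val (volume : Measure ℝ)) := by
  have := sigmaFinite_comap_val
  have hw : Measurable fun x : TimeScale d => ENNReal.ofReal (1 / |(x.2 : ℝ)| ^ (d + 1)) := by
    fun_prop
  unfold timeScaleMeasure
  rw [lintegral_withDensity_eq_lintegral_mul _ hw hg, lintegral_prod_symm' _ (hw.mul hg)]
  refine lintegral_congr fun a => ?_
  simp only [Pi.mul_apply]
  rw [lintegral_const_mul' _ _ ENNReal.ofReal_ne_top]

/-- The time-scale shifts of an admissible rotation invariant wavelet form a Bessel family. -/
theorem exists_isBesselFamily_timeScaleShift (hd : 1 ≤ d) {φ : L2 d} (hφ : IsAdmissible φ)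
    (rφ : IsRotationInvariant φ) :
    ∃ C : ℝ≥0, IsBesselFamily (fun x => timeScaleShift x φ) (timeScaleMeasure d) C := by
  let G : Eucl d → ℝ≥0∞ := fun ω => ‖(𝓕 φ : L2 d) ω‖ₑ ^ 2
  have hG : Measurable G := (Lp.stronglyMeasurable (𝓕 φ : L2 d)).measurable.enorm.pow_const 2
  obtain ⟨C, hC⟩ := calderon_ae_eq_const hd hG hφ.2 fun R hR => by
    filter_upwards [rφ.fourier R hR] with t ht
    simp only [G, ht]
  refine ⟨C, fun f => measurable_inner_timeScaleShift φ f, fun f => ?_⟩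
  have hF : Measurable fun ω => ‖(𝓕 f : L2 d) ω‖ₑ ^ 2 :=
    (Lp.stronglyMeasurable (𝓕 f : L2 d)).measurable.enorm.pow_const 2
  rw [lintegral_timeScaleMeasure ((measurable_inner_timeScaleShift φ f).enorm.pow_const 2)]
  calc ∫⁻ a : {a : ℝ // a ≠ 0}, ENNReal.ofReal (1 / |(a : ℝ)| ^ (d + 1)) *
          (∫⁻ b, ‖(inner ℂ (timeScaleShift (b, a) φ) f : ℂ)‖ₑ ^ 2)
        ∂(Measure.comap Subtype.val (volume : Measure ℝ))
      ≤ ∫⁻ a : {a : ℝ // a ≠ 0}, (∫⁻ ω, ENNReal.ofReal |(a : ℝ)|⁻¹ * G ((a : ℝ) • ω) *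
          ‖(𝓕 f : L2 d) ω‖ₑ ^ 2) ∂(Measure.comap Subtype.val (volume : Measure ℝ)) := by
        refine lintegral_mono fun a => ?_
        refine (mul_le_mul_right (lintegral_translation_inner_sq_le φ f a) _).trans (le_of_eq ?_)
        have ha : 0 < |(a : ℝ)| := abs_pos.2 a.2
        rw [← mul_assoc, ← ENNReal.ofReal_mul (by positivity),
          ← lintegral_const_mul' _ _ ENNReal.ofReal_ne_top]
        refine lintegral_congr fun ω => ?_
        -- The density of the Haar measure times the Plancherel factor leaves da/|a|, the measure of
        -- the Calderón integral.
        have : 1 / |(a : ℝ)| ^ (d + 1) * |(a : ℝ)| ^ d = |(a : ℝ)|⁻¹ := by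
          field_simp
          ring
        rw [this, mul_assoc]
    _ ≤ ∫⁻ a : ℝ, ∫⁻ ω, ENNReal.ofReal |a|⁻¹ * G (a • ω) * ‖(𝓕 f : L2 d) ω‖ₑ ^ 2 := by
        have h := lintegral_subtype_comap (μ := (volume : Measure ℝ)) (s := {a : ℝ | a ≠ 0})
          (measurableSet_singleton (0 : ℝ)).compl
          (fun a : ℝ => ∫⁻ ω, ENNReal.ofReal |a|⁻¹ * G (a • ω) * ‖(𝓕 f : L2 d) ω‖ₑ ^ 2)
        exact h.trans_le (lintegral_mono' Measure.restrict_le_self le_rfl)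
    _ = ∫⁻ ω, ∫⁻ a : ℝ, ENNReal.ofReal |a|⁻¹ * G (a • ω) * ‖(𝓕 f : L2 d) ω‖ₑ ^ 2 :=
        lintegral_lintegral_swap
          (((measurable_calderon_integrand hG).comp measurable_swap).mul
            (hF.comp measurable_snd)).aemeasurable
    _ = ∫⁻ ω, calderon G ω * ‖(𝓕 f : L2 d) ω‖ₑ ^ 2 := by
        refine lintegral_congr fun ω => ?_
        have hm : Measurable fun a : ℝ => ENNReal.ofReal |a|⁻¹ * G (a • ω) :=
          (measurable_calderon_integrand hG).comp measurable_prodMk_left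
        rw [lintegral_mul_const _ hm, calderon]
    _ = ∫⁻ ω, C * ‖(𝓕 f : L2 d) ω‖ₑ ^ 2 := by
        refine lintegral_congr_ae ?_
        filter_upwards [hC] with ω hω
        rw [hω]
    _ = C * ‖f‖ₑ ^ 2 := by
        rw [lintegral_const_mul' _ _ ENNReal.coe_ne_top, ← L2.enorm_sq_eq_lintegral,
          ← ofReal_norm, Lp.norm_fourier_eq, ofReal_norm]

theorem exists_isBesselFamily_tensorShift (hd : 1 ≤ d) {φ₁ φ₂ : L2 d}
    (hφ₁ : IsAdmissible φ₁) (hφ₂ : IsAdmissible φ₂)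
    (rφ₁ : IsRotationInvariant φ₁) (rφ₂ : IsRotationInvariant φ₂) :
    ∃ C : ℝ≥0, IsBesselFamily (tensorShift φ₁ φ₂)
      ((timeScaleMeasure d).prod (timeScaleMeasure d)) C := by
  obtain ⟨C₁, h₁⟩ := exists_isBesselFamily_timeScaleShift hd hφ₁ rφ₁
  obtain ⟨C₂, h₂⟩ := exists_isBesselFamily_timeScaleShift hd hφ₂ rφ₂
  have := sFinite_timeScaleMeasure (d := d)
  exact ⟨C₁ * C₂, h₁.tensor h₂⟩

theorem norm_tensorShift (φ₁ φ₂ : L2 d) (x : TimeScale d × TimeScale d) :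
    ‖tensorShift φ₁ φ₂ x‖ = ‖φ₁‖ * ‖φ₂‖ := by
  rw [tensorShift, simpleTensor, UniformSpace.Completion.norm_coe, TensorProduct.norm_tmul,
    norm_timeScaleShift, norm_timeScaleShift]

end WaveletBessel

/-! ### Conclusion for the tensor wavelets -/

theorem proposition6p6 (d : ℕ) (hd : 1 ≤ d) (φ₁ φ₂ ψ₁ ψ₂ : L2 d)
    (hφ₁ : IsAdmissible φ₁) (hφ₂ : IsAdmissible φ₂)
    (hψ₁ : IsAdmissible ψ₁) (hψ₂ : IsAdmissible ψ₂)
    (rφ₁ : IsRotationInvariant φ₁) (rφ₂ : IsRotationInvariant φ₂)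
    (rψ₁ : IsRotationInvariant ψ₁) (rψ₂ : IsRotationInvariant ψ₂)
    (nφ₁ : ‖φ₁‖ = 1) (nφ₂ : ‖φ₂‖ = 1) (nψ₁ : ‖ψ₁‖ = 1) (nψ₂ : ‖ψ₂‖ = 1)
    (p : ℝ) (hp : 1 ≤ p) (m : TimeScale d × TimeScale d → ℂ)
    (hm : MemLp m (ENNReal.ofReal p) ((timeScaleMeasure d).prod (timeScaleMeasure d))) :
    (∃! M : L2Tensor d →L[ℂ] L2Tensor d, IsLocalizationOperator m φ₁ φ₂ ψ₁ ψ₂ M) ∧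
      ∀ M : L2Tensor d →L[ℂ] L2Tensor d,
        IsLocalizationOperator m φ₁ φ₂ ψ₁ ψ₂ M → IsSchatten p M := by
  obtain ⟨C, hC⟩ := exists_isBesselFamily_tensorShift hd hφ₁ hφ₂ rφ₁ rφ₂
  obtain ⟨D, hD⟩ := exists_isBesselFamily_tensorShift hd hψ₁ hψ₂ rψ₁ rψ₂
  -- The abstract results use one Bessel constant for both families, hence the maximum.
  have hΦ := hC.mono (le_max_left C D)
  have hΨ := hD.mono (le_max_right C D)
  have hΦ1 : ∀ x, ‖tensorShift φ₁ φ₂ x‖ ≤ 1 := fun x => by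
    rw [norm_tensorShift, nφ₁, nφ₂, mul_one]
  have hΨ1 : ∀ x, ‖tensorShift ψ₁ ψ₂ x‖ ≤ 1 := fun x => by
    rw [norm_tensorShift, nψ₁, nψ₂, mul_one]
  refine ⟨?_, fun M hM => isSchatten_of_inner_eq_integral hΦ hΨ hΦ1 hΨ1 hp hm fun f g =>
    (hM f g).2⟩
  obtain ⟨M, hM⟩ := exists_localization_operator hΦ hΨ hΦ1 hΨ1 hp hm
  refine ⟨M, fun f g => ⟨integrable_symbol_mul hΦ hΨ hΦ1 hΨ1 hp hm f g, hM f g⟩, fun M' hM' => ?_⟩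
  refine ContinuousLinearMap.ext fun f => ext_inner_left ℂ fun g => ?_
  rw [(hM' f g).2, hM f g]
  rfl
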